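/- For a complex vector space $X$ let $\mathbb{M}_n(X)$ be the space of $n\times n$ matrices over $X$. A *numerical radius operator space* is a complex vector space $X$ with a norm $\mathcal{W}_n$ on each $\mathbb{M}_n(X)$ such that, for all $x\in\mathbb{M}_m(X)$, $y\in\mathbb{M}_n(X)$ and all complex $n\times m$ matrices $\alpha$ (with operator norm $\|\alpha\|$), $$\mathcal{W}_{m+n}\begin{pmatrix}x&0\\0&y\end{pmatrix}=\max\{\mathcal{W}_m(x),\mathcal{W}_n(y)\},\qquad \mathcal{W}_n(\alpha x\alpha^*)\le\|\alpha\|^2\,\mathcal{W}_m(x).$$ For example, $\mathbb{C}$ is one, with the numerical radius $w(a)=\sup\{|(a\xi|\xi)|:\|\xi\|=1\}$ on $\mathbb{M}_n(\mathbb{C})$. For a linear map $\varphi:X\to Y$ between such spaces put $\varphi_n([x_{ij}])=[\varphi(x_{ij})]$ and $$\mathcal{W}(\varphi)_{cb}=\sup_n\,\sup\{\mathcal{W}_n(\varphi_n(x)):x\in\mathbb{M}_n(X),\ \mathcal{W}_n(x)\le1\}.$$ Call $\varphi$ *$\mathcal{W}$-completely bounded* if $\mathcal{W}(\varphi)_{cb}<\infty$,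 and *$\mathcal{W}$-completely isometric* if $\mathcal{W}_n(\varphi_n(x))=\mathcal{W}_n(x)$ for all $n$ and $x\in\mathbb{M}_n(X)$. Let $\mathcal{W}CB(X,Y)$ be the space of $\mathcal{W}$-completely bounded maps. Give $\mathbb{M}_n(Y)$ the matrix norms coming from $\mathbb{M}_k(\mathbb{M}_n(Y))=\mathbb{M}_{kn}(Y)$. **Proposition 2.7.** Let $X$ and $Y$ be numerical radius operator spaces. 1. A matrix $[\varphi_{ij}]$ of linear maps $X\to Y$ has all its entries in $\mathcal{W}CB(X,Y)$ if and only if the map $x\mapsto[\varphi_{ij}(x)]$ is in $\mathcal{W}CB(X,\mathbb{M}_n(Y))$. With the norm $\mathcal{W}_n([\varphi_{ij}])=\mathcal{W}(x\mapsto[\varphi_{ij}(x)])_{cb}$ on $\mathbb{M}_n(\mathcal{W}CB(X,Y))$ for each $n$, $\mathcal{W}CB(X,Y)$ is a numerical radius operator space. 2. Let $X^*=\mathcal{W}CB(X,\mathbb{C})$ and $X^{**}=\mathcal{W}CB(X^*,\mathbb{C})$, with the matrix norms of (1). Then $X^*$ consists exactly of the linear functionals on $X$ that are bounded for $\mathcal{W}_1$,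 and the canonical inclusion $X\to X^{**}$, $x\mapsto(f\mapsto f(x))$, is well defined and $\mathcal{W}$-completely isometric. 3. If $N$ is a subspace of $X$ that is closed for $\mathcal{W}_1$, then $X/N$ is a numerical radius operator space with the quotient norms of $\mathbb{M}_n(X/N)=\mathbb{M}_n(X)/\mathbb{M}_n(N)$, that is, $\mathcal{W}_n(A)=\inf\{\mathcal{W}_n(x):x\in\mathbb{M}_n(X)\text{ represents }A\}$. -/

import Mathlib

open scoped Matrix ENNReal

noncomputable section

namespace NumRad

universe u v

/-- A family of real-valued functions `W n` on the spaces `M_n(X)` of `n × n` matrices over `X`. -/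
abbrev MatrixNorms (X : Type u) : Type u :=
  (n : ℕ) → Matrix (Fin n) (Fin n) X → ℝ

/-- The operator norm of a rectangular complex matrix, acting between Euclidean spaces. -/
def opNorm {m n : ℕ} (α : Matrix (Fin n) (Fin m) ℂ) : ℝ :=
  ‖LinearMap.toContinuousLinearMap (Matrix.toEuclideanLin α)‖

/-- The block diagonal matrix with diagonal blocks `x` and `y`. -/
def blockDiag {X : Type u} [Zero X] {m n : ℕ}
    (x : Matrix (Fin m) (Fin m) X) (y : Matrix (Fin n) (Fin n) X) :
    Matrix (Fin (m + n)) (Fin (m + n)) X :=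
  Matrix.reindex finSumFinEquiv finSumFinEquiv (Matrix.fromBlocks x 0 0 y)

/-- The product `α x α*` of a scalar matrix, a matrix over `X` and a scalar matrix. -/
def conj {X : Type u} [AddCommGroup X] [Module ℂ X] {m n : ℕ}
    (α : Matrix (Fin n) (Fin m) ℂ) (x : Matrix (Fin m) (Fin m) X) :
    Matrix (Fin n) (Fin n) X :=
  Matrix.of fun i j => ∑ k, ∑ l, (α i k * star (α j l)) • x k l

/-- `(X, W)` is a numerical radius operator space: every `W n` is a norm on `M_n(X)`, and the
two conditions WI and WII hold. (At `n = 0` the space `M_0(X)` is zero and nothing is added.) -/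
structure IsNumRadSpace {X : Type u} [AddCommGroup X] [Module ℂ X] (W : MatrixNorms X) : Prop where
  add_le : ∀ (n : ℕ) (x y : Matrix (Fin n) (Fin n) X), W n (x + y) ≤ W n x + W n y
  smul_eq : ∀ (n : ℕ) (c : ℂ) (x : Matrix (Fin n) (Fin n) X), W n (c • x) = ‖c‖ * W n x
  eq_zero : ∀ (n : ℕ) (x : Matrix (Fin n) (Fin n) X), W n x = 0 → x = 0
  /-- WI -/
  blockDiag_eq : ∀ (m n : ℕ) (x : Matrix (Fin m) (Fin m) X) (y : Matrix (Fin n) (Fin n) X),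
    W (m + n) (blockDiag x y) = max (W m x) (W n y)
  /-- WII -/
  conj_le : ∀ (m n : ℕ) (α : Matrix (Fin n) (Fin m) ℂ) (x : Matrix (Fin m) (Fin m) X),
    W n (conj α x) ≤ opNorm α ^ 2 * W m x

section Maps

variable {X : Type u} [AddCommGroup X] [Module ℂ X] {Y : Type v} [AddCommGroup Y] [Module ℂ Y]

/-- The `W`-completely bounded norm of a linear map `φ`, as an extended nonnegative number: the
supremum over `n` of `sup {W (φ_n x) | x ∈ M_n(X), W x ≤ 1}`, where `φ_n [x_ij] = [φ x_ij]`. -/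
def cbNorm (WX : MatrixNorms X) (WY : MatrixNorms Y) (φ : X →ₗ[ℂ] Y) : ℝ≥0∞ :=
  ⨆ (n : ℕ) (x : Matrix (Fin n) (Fin n) X) (_ : WX n x ≤ 1), ENNReal.ofReal (WY n (x.map φ))

/-- `φ` is a `W`-complete isometry: every `φ_n` preserves the matrix norm. -/
def IsCompleteIsometry (WX : MatrixNorms X) (WY : MatrixNorms Y) (φ : X →ₗ[ℂ] Y) : Prop :=
  ∀ (n : ℕ) (x : Matrix (Fin n) (Fin n) X), WY n (x.map φ) = WX n x

/-- The space of `W`-completely bounded maps from `X` to a numerical radius operator space `Y`. -/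
def WCB (WX : MatrixNorms X) (WY : MatrixNorms Y) (hY : IsNumRadSpace WY) :
    Submodule ℂ (X →ₗ[ℂ] Y) where
  carrier := {φ | cbNorm WX WY φ < ∞}
  zero_mem' := by
    have h0 : ∀ n, WY n 0 = 0 := fun n => by simpa using hY.smul_eq n 0 0
    have : cbNorm WX WY 0 = 0 := by
      simp only [cbNorm, ENNReal.iSup_eq_zero]
      intro n x _
      have : x.map (0 : X →ₗ[ℂ] Y) = 0 := by ext i j; simp
      rw [this, h0]; simp
    simp [this]
  add_mem' := by
    intro φ ψ hφ hψ
    refine lt_of_le_of_lt ?_ (ENNReal.add_lt_top.2 ⟨hφ, hψ⟩)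
    refine iSup_le fun n => iSup_le fun x => iSup_le fun hx => ?_
    have h : x.map (φ + ψ) = x.map φ + x.map ψ := by ext i j; simp
    rw [h]
    refine (ENNReal.ofReal_le_ofReal (hY.add_le n _ _)).trans
      (ENNReal.ofReal_add_le.trans (add_le_add ?_ ?_))
    · exact le_iSup_of_le n (le_iSup_of_le x (le_iSup_of_le hx le_rfl))
    · exact le_iSup_of_le n (le_iSup_of_le x (le_iSup_of_le hx le_rfl))
  smul_mem' := by
    intro c φ hφ
    refine lt_of_le_of_lt ?_ (ENNReal.mul_lt_top (a := ENNReal.ofReal ‖c‖) (by simp) hφ)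
    refine iSup_le fun n => iSup_le fun x => iSup_le fun hx => ?_
    have h : x.map (c • φ) = c • x.map φ := by ext i j; simp
    rw [h, hY.smul_eq, ENNReal.ofReal_mul (norm_nonneg c)]
    gcongr
    exact le_iSup_of_le n (le_iSup_of_le x (le_iSup_of_le hx le_rfl))

/-- The matrix norms of the space `M_n(Y)`, through `M_k(M_n(Y)) = M_{kn}(Y)`. -/
def matNorms (WY : MatrixNorms Y) (n : ℕ) : MatrixNorms (Matrix (Fin n) (Fin n) Y) :=
  fun k A => WY (k * n)
    (Matrix.reindex finProdFinEquiv finProdFinEquiv (Matrix.comp _ _ _ _ Y A))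

/-- The map `x ↦ [φ_ij x]` from `X` to `M_n(Y)` given by a matrix `[φ_ij]` of linear maps. -/
def toMatrixMap {n : ℕ} (φ : Matrix (Fin n) (Fin n) (X →ₗ[ℂ] Y)) :
    X →ₗ[ℂ] Matrix (Fin n) (Fin n) Y where
  toFun x := Matrix.of fun i j => φ i j x
  map_add' x y := by ext i j; simp
  map_smul' c x := by ext i j; simp

/-- The matrix norms of `WCB(X, Y)`: the norm of `φ = [φ_ij]` in `M_n(WCB(X, Y))` is the
`W`-completely bounded norm of the map `x ↦ [φ_ij x]` from `X` to `M_n(Y)`. -/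
def wcbNorms (WX : MatrixNorms X) (WY : MatrixNorms Y) (hY : IsNumRadSpace WY) :
    MatrixNorms (WCB WX WY hY) :=
  fun n φ => (cbNorm WX (matNorms WY n)
    (toMatrixMap (φ.map fun f => (f : X →ₗ[ℂ] Y)))).toReal

/-- The subspace `N` of `X` is closed for the norm `W 1` on `X = M_1(X)`: it contains each of its
limit points. -/
def IsClosedSubspace (W : MatrixNorms X) (N : Submodule ℂ X) : Prop :=
  ∀ x : X, (∀ ε : ℝ, 0 < ε → ∃ y ∈ N, W 1 (Matrix.of fun _ _ => x - y) < ε) → x ∈ N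

/-- The quotient norms on `M_n(X/N) = M_n(X)/M_n(N)`: the infimum of the norms of the
representatives. -/
def quotNorms (W : MatrixNorms X) (N : Submodule ℂ X) : MatrixNorms (X ⧸ N) :=
  fun n A => ⨅ x : {x : Matrix (Fin n) (Fin n) X // x.map N.mkQ = A}, W n x

end Maps

/-- The numerical radius `w(a) = sup {|(a ξ | ξ)| : ‖ξ‖ = 1}` of complex `n × n` matrices. -/
def numRadius : MatrixNorms ℂ :=
  fun n a => ⨆ ξ : {ξ : EuclideanSpace ℂ (Fin n) // ‖ξ‖ = 1},
    ‖inner ℂ (ξ : EuclideanSpace ℂ (Fin n)) (Matrix.toEuclideanLin a ξ)‖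

theorem numRadius_bdd (n : ℕ) (a : Matrix (Fin n) (Fin n) ℂ) :
    BddAbove (Set.range fun ξ : {ξ : EuclideanSpace ℂ (Fin n) // ‖ξ‖ = 1} =>
      ‖inner ℂ (ξ : EuclideanSpace ℂ (Fin n)) (Matrix.toEuclideanLin a ξ)‖) := by
  refine ⟨opNorm a, ?_⟩
  rintro _ ⟨⟨ξ, hξ⟩, rfl⟩
  have h := (LinearMap.toContinuousLinearMap (Matrix.toEuclideanLin a)).le_opNorm ξ
  refine (norm_inner_le_norm _ _).trans ?_
  simpa [hξ, opNorm] using h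

theorem numRadius_nonneg (n : ℕ) (a : Matrix (Fin n) (Fin n) ℂ) : 0 ≤ numRadius n a :=
  Real.iSup_nonneg fun _ => norm_nonneg _

theorem inner_le_numRadius {n : ℕ} (a : Matrix (Fin n) (Fin n) ℂ)
    (ξ : EuclideanSpace ℂ (Fin n)) :
    ‖inner ℂ ξ (Matrix.toEuclideanLin a ξ)‖ ≤ numRadius n a * ‖ξ‖ ^ 2 := by
  by_cases h : ξ = 0
  · simp [h]
  have hn : ‖ξ‖ ≠ 0 := norm_ne_zero_iff.2 h
  have h1 : ‖((‖ξ‖⁻¹ : ℝ) : ℂ) • ξ‖ = 1 := by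
    rw [norm_smul]; simp [hn]
  have h2 := le_ciSup (numRadius_bdd n a) ⟨((‖ξ‖⁻¹ : ℝ) : ℂ) • ξ, h1⟩
  have h3 : ‖inner ℂ (((‖ξ‖⁻¹ : ℝ) : ℂ) • ξ)
      (Matrix.toEuclideanLin a (((‖ξ‖⁻¹ : ℝ) : ℂ) • ξ))‖
      = ‖inner ℂ ξ (Matrix.toEuclideanLin a ξ)‖ / ‖ξ‖ ^ 2 := by
    rw [map_smul, inner_smul_left, inner_smul_right, norm_mul, norm_mul]
    simp
    field_simp
  have h4 : ‖inner ℂ ξ (Matrix.toEuclideanLin a ξ)‖ / ‖ξ‖ ^ 2 ≤ numRadius n a := by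
    rw [← h3]; exact h2
  rwa [div_le_iff₀ (by positivity)] at h4

theorem inner_toEuclideanLin {n : ℕ} (a : Matrix (Fin n) (Fin n) ℂ)
    (ξ : EuclideanSpace ℂ (Fin n)) :
    inner ℂ ξ (Matrix.toEuclideanLin a ξ) = ∑ i, ∑ j, a i j * ξ j * star (ξ i) := by
  simp [PiLp.inner_apply, Matrix.toLpLin_apply, Matrix.mulVec, dotProduct, Finset.sum_mul]

theorem inner_blockDiag {m n : ℕ} (x : Matrix (Fin m) (Fin m) ℂ) (y : Matrix (Fin n) (Fin n) ℂ)
    (ξ : EuclideanSpace ℂ (Fin (m + n))) :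
    inner ℂ ξ (Matrix.toEuclideanLin (blockDiag x y) ξ) =
      inner ℂ (WithLp.toLp 2 fun i => ξ (Fin.castAdd n i))
        (Matrix.toEuclideanLin x (WithLp.toLp 2 fun i => ξ (Fin.castAdd n i))) +
      inner ℂ (WithLp.toLp 2 fun i => ξ (Fin.natAdd m i))
        (Matrix.toEuclideanLin y (WithLp.toLp 2 fun i => ξ (Fin.natAdd m i))) := by
  simp only [inner_toEuclideanLin]
  simp [Fin.sum_univ_add, blockDiag]

theorem norm_sq_split {m n : ℕ} (ξ : EuclideanSpace ℂ (Fin (m + n))) :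
    ‖ξ‖ ^ 2 = ‖(WithLp.toLp 2 fun i => ξ (Fin.castAdd n i) : EuclideanSpace ℂ (Fin m))‖ ^ 2 +
      ‖(WithLp.toLp 2 fun i => ξ (Fin.natAdd m i) : EuclideanSpace ℂ (Fin n))‖ ^ 2 := by
  simp [EuclideanSpace.norm_sq_eq, Fin.sum_univ_add]

theorem conj_eq_mul {m n : ℕ} (α : Matrix (Fin n) (Fin m) ℂ) (x : Matrix (Fin m) (Fin m) ℂ) :
    conj α x = α * x * αᴴ := by
  ext i j
  simp only [conj, Matrix.of_apply, Matrix.mul_apply, Matrix.conjTranspose_apply, smul_eq_mul,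
    Finset.sum_mul]
  rw [Finset.sum_comm]
  exact Finset.sum_congr rfl fun _ _ => Finset.sum_congr rfl fun _ _ => by ring

theorem inner_conj {m n : ℕ} (α : Matrix (Fin n) (Fin m) ℂ) (x : Matrix (Fin m) (Fin m) ℂ)
    (ξ : EuclideanSpace ℂ (Fin n)) :
    inner ℂ ξ (Matrix.toEuclideanLin (conj α x) ξ) =
      inner ℂ (Matrix.toEuclideanLin αᴴ ξ)
        (Matrix.toEuclideanLin x (Matrix.toEuclideanLin αᴴ ξ)) := by
  have h : Matrix.toEuclideanLin (conj α x) ξ =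
      Matrix.toEuclideanLin α (Matrix.toEuclideanLin x (Matrix.toEuclideanLin αᴴ ξ)) := by
    simp [conj_eq_mul, Matrix.toLpLin_apply, Matrix.mul_assoc]
  rw [h, Matrix.toEuclideanLin_conjTranspose_eq_adjoint, LinearMap.adjoint_inner_left]

open scoped Matrix.Norms.L2Operator in
theorem norm_conjTranspose_le {m n : ℕ} (α : Matrix (Fin n) (Fin m) ℂ)
    (ξ : EuclideanSpace ℂ (Fin n)) : ‖Matrix.toEuclideanLin αᴴ ξ‖ ≤ opNorm α * ‖ξ‖ := by
  have h : opNorm αᴴ = opNorm α := Matrix.l2_opNorm_conjTranspose α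
  have h2 := (LinearMap.toContinuousLinearMap (Matrix.toEuclideanLin αᴴ)).le_opNorm ξ
  rw [← h]
  exact h2

/-- The complex numbers with the numerical radius of complex matrices form a numerical radius
operator space. -/
theorem isNumRadSpace_complex : IsNumRadSpace numRadius where
  add_le n x y := by
    refine Real.iSup_le ?_ (add_nonneg (numRadius_nonneg n x) (numRadius_nonneg n y))
    rintro ⟨ξ, hξ⟩
    have hx := inner_le_numRadius x ξ
    have hy := inner_le_numRadius y ξ
    simp only [hξ, one_pow, mul_one] at hx hy
    simp only [map_add, LinearMap.add_apply, inner_add_right]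
    exact (norm_add_le _ _).trans (add_le_add hx hy)
  smul_eq n c x := by
    simp only [numRadius, map_smul, LinearMap.smul_apply, inner_smul_right, norm_mul]
    rw [Real.mul_iSup_of_nonneg (norm_nonneg c)]
  eq_zero n x hx := by
    have h : ∀ ξ, inner ℂ (Matrix.toEuclideanLin x ξ) ξ = 0 := fun ξ => by
      have := inner_le_numRadius x ξ
      rw [hx, zero_mul] at this
      rw [← inner_conj_symm, norm_le_zero_iff.1 this, map_zero]
    exact (Matrix.toEuclideanLin (𝕜 := ℂ)).map_eq_zero_iff.1 ((inner_map_self_eq_zero _).1 h)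
  blockDiag_eq m n x y := by
    refine le_antisymm (Real.iSup_le ?_ (le_max_of_le_left (numRadius_nonneg m x)))
      (max_le (Real.iSup_le ?_ (numRadius_nonneg _ _)) (Real.iSup_le ?_ (numRadius_nonneg _ _)))
    · rintro ⟨ξ, hξ⟩
      have hs := norm_sq_split ξ
      rw [hξ, one_pow] at hs
      dsimp only
      rw [inner_blockDiag]
      refine (norm_add_le _ _).trans ((add_le_add (inner_le_numRadius x _)
        (inner_le_numRadius y _)).trans ?_)
      refine (add_le_add (mul_le_mul_of_nonneg_right (le_max_left _ (numRadius n y))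
        (sq_nonneg _)) (mul_le_mul_of_nonneg_right (le_max_right (numRadius m x) _)
        (sq_nonneg _))).trans ?_
      rw [← mul_add, ← hs, mul_one]
    · rintro ⟨ξ, hξ⟩
      have h := inner_le_numRadius (blockDiag x y) (WithLp.toLp 2 (Fin.append ξ (0 : Fin n → ℂ)))
      rw [norm_sq_split, inner_blockDiag] at h
      have e0 : (WithLp.toLp 2 fun _ : Fin n => (0 : ℂ)) = 0 := rfl
      simpa [hξ, e0] using h
    · rintro ⟨ξ, hξ⟩
      have h := inner_le_numRadius (blockDiag x y) (WithLp.toLp 2 (Fin.append (0 : Fin m → ℂ) ξ))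
      rw [norm_sq_split, inner_blockDiag] at h
      have e0 : (WithLp.toLp 2 fun _ : Fin m => (0 : ℂ)) = 0 := rfl
      simpa [hξ, e0] using h
  conj_le m n α x := by
    refine Real.iSup_le ?_ (mul_nonneg (sq_nonneg _) (numRadius_nonneg m x))
    rintro ⟨ξ, hξ⟩
    have h := norm_conjTranspose_le α ξ
    rw [hξ, mul_one] at h
    dsimp only
    rw [inner_conj, mul_comm]
    refine (inner_le_numRadius x _).trans
      (mul_le_mul_of_nonneg_left ?_ (numRadius_nonneg m x))
    exact pow_le_pow_left₀ (norm_nonneg _) h 2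

/-- The dual `X* = WCB(X, ℂ)` of a numerical radius operator space. -/
abbrev Dual {X : Type u} [AddCommGroup X] [Module ℂ X] (W : MatrixNorms X) :
    Submodule ℂ (X →ₗ[ℂ] ℂ) :=
  WCB W numRadius isNumRadSpace_complex

/-- The matrix norms of the dual: `M_n(X*) = WCB(X, M_n(ℂ))`. -/
abbrev dualNorms {X : Type u} [AddCommGroup X] [Module ℂ X] (W : MatrixNorms X) :
    MatrixNorms (Dual W) :=
  wcbNorms W numRadius isNumRadSpace_complex

end NumRad

end

noncomputable section

namespace NumRad

/-! Parts (1) and (3) transport the two axioms; the depth lies in the lower bound for the bidual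
map.

WII controls only products `α x α*`. Polarization (`sandwich_polarization`) turns this into a bound
for `α x β*` with a constant, which suffices to compare a matrix with its entries. Norms on matrices
over arbitrary finite index types (`finNorm`) let `[φ_ij x_ab]` be indexed by pairs. In this form a
block sum of maps amplifies to a block sum, and `α φ α*` amplifies to `(1 ⊗ α) [φ_ij x_ab] (1 ⊗
α)*`, so `WCB(X, Y)` inherits WI and WII from `Y`.

For the quotient, WI and WII pass through infima over representatives; closedness of `N` gives
definiteness because entries are bounded by a multiple of the matrix norm.

For the bidual, the task is to find, for `x₀` in `M_n(X)` and `ε > 0`, a complete contraction `φ : X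
→ M_n(ℂ)` with `W x₀ ≤ (1 + ε) w(φ_n x₀)` (`exists_contractive_amp`). A Hahn-Banach argument in the
form of M. Riesz's extension theorem, on a cone that is convex by WI, yields a functional `f` on
`M_n(X)` attaining `W x₀` at `x₀` and a density matrix `R` with `|f(α x α*)| ≤ tr(R α α*) W x`
(`exists_pairing_dominated`). After a small perturbation `R` is written as `B* B` with `B`
invertible, and `f` is conjugated by `B⁻¹`: the weight `R` becomes at most the identity, so the
quadratic forms of `φ_k x` are bounded by `W x ‖ξ‖²`, while the vector formed from the entries of
`B`, of squared norm at most `1 + ε`, recovers `f(x₀)`. -/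

/-- The product `α x β*` for matrices over arbitrary finite index types. -/
def sandwich {X ι κ : Type*} [AddCommGroup X] [Module ℂ X] [Fintype κ]
    (α : Matrix ι κ ℂ) (x : Matrix κ κ X) (β : Matrix ι κ ℂ) : Matrix ι ι X :=
  Matrix.of fun i j => ∑ k, ∑ l, (α i k * star (β j l)) • x k l

/-- The square of the operator norm of `α*` is at most `c`. -/
def SqBound {ι κ : Type*} [Fintype ι] [Fintype κ] (α : Matrix ι κ ℂ) (c : ℝ) : Prop :=
  ∀ ξ : ι → ℂ, ∑ j, ‖∑ i, star (α i j) * ξ i‖ ^ 2 ≤ c * ∑ i, ‖ξ i‖ ^ 2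

/-- The extension of the norms `W n` to matrices indexed by a finite type. -/
def finNorm {X ι : Type*} [Fintype ι] (W : MatrixNorms X) (x : Matrix ι ι X) : ℝ :=
  W (Fintype.card ι) (x.submatrix (Fintype.equivFin ι).symm (Fintype.equivFin ι).symm)

theorem opNorm_nonneg {m n : ℕ} (α : Matrix (Fin n) (Fin m) ℂ) : 0 ≤ opNorm α := norm_nonneg _

theorem norm_sq_conjTranspose {m n : ℕ} (α : Matrix (Fin n) (Fin m) ℂ)
    (ξ : EuclideanSpace ℂ (Fin n)) :
    ‖Matrix.toEuclideanLin αᴴ ξ‖ ^ 2 = ∑ j, ‖∑ i, star (α i j) * ξ i‖ ^ 2 := by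
  simp [EuclideanSpace.norm_sq_eq, Matrix.toLpLin_apply, Matrix.mulVec, dotProduct]

theorem sqBound_opNorm {m n : ℕ} (α : Matrix (Fin n) (Fin m) ℂ) : SqBound α (opNorm α ^ 2) := by
  intro ξ
  have h := norm_conjTranspose_le α (WithLp.toLp 2 ξ)
  have h2 := pow_le_pow_left₀ (norm_nonneg _) h 2
  rw [norm_sq_conjTranspose, mul_pow, EuclideanSpace.norm_sq_eq] at h2
  exact h2

open scoped Matrix.Norms.L2Operator in
theorem SqBound.opNorm_sq_le {m n : ℕ} {α : Matrix (Fin n) (Fin m) ℂ} {c : ℝ} (h : SqBound α c)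
    (hc : 0 ≤ c) : opNorm α ^ 2 ≤ c := by
  have h1 : opNorm αᴴ = opNorm α := Matrix.l2_opNorm_conjTranspose α
  rw [← h1]
  have h2 : opNorm αᴴ ≤ Real.sqrt c := by
    refine ContinuousLinearMap.opNorm_le_bound _ (Real.sqrt_nonneg c) fun ξ => ?_
    refine abs_le_of_sq_le_sq' ?_ (by positivity) |>.2
    rw [mul_pow, Real.sq_sqrt hc]
    have := h ξ
    rw [← norm_sq_conjTranspose, ← EuclideanSpace.norm_sq_eq] at this
    exact this
  calc opNorm αᴴ ^ 2 ≤ Real.sqrt c ^ 2 := pow_le_pow_left₀ (opNorm_nonneg _) h2 2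
    _ = c := Real.sq_sqrt hc

/-! ### Bounds for scalar coefficient matrices. -/

section SqBound

variable {ι κ ι' κ' : Type*} [Fintype ι] [Fintype κ] [Fintype ι'] [Fintype κ']

theorem SqBound.submatrix {α : Matrix ι κ ℂ} {c : ℝ} (h : SqBound α c) (e : ι' ≃ ι) (f : κ' ≃ κ) :
    SqBound (α.submatrix e f) c := by
  intro ξ
  have := h (ξ ∘ e.symm)
  rw [← f.sum_comp, ← e.sum_comp (fun i => ‖(ξ ∘ e.symm) i‖ ^ 2)] at this
  simp_rw [← e.sum_comp (fun i => star (α i _) * (ξ ∘ e.symm) i)] at this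
  simpa using this

theorem SqBound.nonneg [Nonempty ι] {α : Matrix ι κ ℂ} {c : ℝ} (h : SqBound α c) : 0 ≤ c := by
  have := (Finset.sum_nonneg fun _ _ => sq_nonneg _).trans (h fun _ => 1)
  simp only [norm_one, one_pow, Finset.sum_const, nsmul_eq_mul, mul_one] at this
  exact nonneg_of_mul_nonneg_left this (by simpa using Fintype.card_pos)

theorem SqBound.smul {α : Matrix ι κ ℂ} {c : ℝ} (h : SqBound α c) (z : ℂ) :
    SqBound (z • α) (‖z‖ ^ 2 * c) := by
  intro ξ
  have : ∀ j, ∑ i, star ((z • α) i j) * ξ i = star z * ∑ i, star (α i j) * ξ i := fun j => by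
    simp [Finset.mul_sum, mul_assoc]
  simp only [this, norm_mul, norm_star, mul_pow, ← Finset.mul_sum]
  rw [mul_assoc]
  exact mul_le_mul_of_nonneg_left (h ξ) (by positivity)

theorem SqBound.add {α β : Matrix ι κ ℂ} {a b : ℝ} (hα : SqBound α a) (hβ : SqBound β b) :
    SqBound (α + β) (2 * (a + b)) := by
  intro ξ
  have h : ∀ j, ‖∑ i, star ((α + β) i j) * ξ i‖ ^ 2 ≤
      2 * (‖∑ i, star (α i j) * ξ i‖ ^ 2 + ‖∑ i, star (β i j) * ξ i‖ ^ 2) := fun j => by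
    have e : ∑ i, star ((α + β) i j) * ξ i =
        ∑ i, star (α i j) * ξ i + ∑ i, star (β i j) * ξ i := by
      simp [add_mul, Finset.sum_add_distrib]
    rw [e]
    refine (pow_le_pow_left₀ (norm_nonneg _) (norm_add_le _ _) 2).trans ?_
    nlinarith [sq_nonneg (‖∑ i, star (α i j) * ξ i‖ - ‖∑ i, star (β i j) * ξ i‖)]
  refine (Finset.sum_le_sum fun j _ => h j).trans ?_
  rw [← Finset.mul_sum, Finset.sum_add_distrib]
  nlinarith [hα ξ, hβ ξ]

/-- The adjoint of this matrix carries the coordinates of a vector along `f` and fills up with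
zeros, hence is isometric. -/
theorem sqBound_one_submatrix [DecidableEq κ] {f : ι → κ} (hf : Function.Injective f) :
    SqBound ((1 : Matrix κ κ ℂ).submatrix f id) 1 := by
  classical
  intro ξ
  have h : ∀ k, k ∉ Finset.univ.image f →
      ‖∑ i, star ((1 : Matrix κ κ ℂ).submatrix f id i k) * ξ i‖ ^ 2 = 0 := by
    intro k hk
    have : ∀ i, f i ≠ k := by simpa using hk
    simp [this]
  rw [one_mul, ← Finset.sum_subset (Finset.subset_univ (Finset.univ.image f)) fun k _ hk => h k hk,
    Finset.sum_image hf.injOn]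
  refine le_of_eq (Finset.sum_congr rfl fun i _ => ?_)
  simp [Matrix.one_apply, hf.eq_iff, apply_ite]

/-- The bound of `1 ⊗ α`. -/
theorem SqBound.one_kronecker {μ : Type*} [Fintype μ] [DecidableEq μ] {α : Matrix ι κ ℂ} {c : ℝ}
    (h : SqBound α c) :
    SqBound (Matrix.of fun (p : μ × ι) (q : μ × κ) => if p.1 = q.1 then α p.2 q.2 else 0) c := by
  intro ξ
  simp only [Fintype.sum_prod_type, Finset.mul_sum]
  refine Finset.sum_le_sum fun a _ => ?_
  rw [← Finset.mul_sum]
  refine le_of_eq_of_le ?_ (h fun i => ξ (a, i))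
  refine Finset.sum_congr rfl fun j _ => ?_
  congr 2
  rw [Finset.sum_eq_single a]
  · simp
  · intro b _ hb; simp [hb]
  · simp

theorem sqBound_row (ξ : κ → ℂ) : SqBound (Matrix.of fun (_ : Fin 1) j => ξ j) (∑ j, ‖ξ j‖ ^ 2) := by
  intro t
  simp [mul_pow, Finset.sum_mul]

/-- The matrix `1 ⊗ e_i`. -/
def slot (μ : Type*) [DecidableEq μ] [DecidableEq ι] (i : ι) : Matrix (μ × ι) μ ℂ :=
  Matrix.of fun p b => if p.1 = b ∧ p.2 = i then 1 else 0

theorem sqBound_slot (μ : Type*) [Fintype μ] [DecidableEq μ] [DecidableEq ι] (i : ι) :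
    SqBound (slot μ i) 1 := by
  intro ξ
  rw [one_mul, Fintype.sum_prod_type]
  refine Finset.sum_le_sum fun a _ => ?_
  refine le_of_eq_of_le ?_ (Finset.single_le_sum (fun _ _ => sq_nonneg _) (Finset.mem_univ i))
  congr 2
  rw [Finset.sum_eq_single (a, i)]
  · simp [slot]
  · rintro ⟨b, j⟩ _ hb
    have : ¬ (b = a ∧ j = i) := by simpa using hb
    simp [slot, this]
  · simp

theorem sqBound_slot_transpose (μ : Type*) [Fintype μ] [DecidableEq μ] [DecidableEq ι] (i : ι) :
    SqBound (slot μ i)ᵀ 1 := by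
  intro ξ
  rw [one_mul, Fintype.sum_prod_type]
  refine Finset.sum_le_sum fun a _ => le_of_eq ?_
  rw [Finset.sum_eq_single i]
  · simp [slot, apply_ite]
  · intro j _ hj
    simp [slot, hj]
  · simp

end SqBound

/-! ### Polarization and matrix norms over finite index types. -/

section Norms

variable {X : Type*} [AddCommGroup X] [Module ℂ X] {W : MatrixNorms X}
variable {ι κ ι' κ' : Type*} [Fintype ι] [Fintype κ] [Fintype ι'] [Fintype κ']

theorem sandwich_polarization {ι : Type*} (α β : Matrix ι κ ℂ) (x : Matrix κ κ X) :
    sandwich α x β = (4⁻¹ : ℂ) • (sandwich (α + β) x (α + β) + (-1 : ℂ) •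
      sandwich (α + (-1 : ℂ) • β) x (α + (-1 : ℂ) • β) + Complex.I •
      sandwich (α + Complex.I • β) x (α + Complex.I • β) + (-Complex.I) •
      sandwich (α + (-Complex.I) • β) x (α + (-Complex.I) • β)) := by
  ext i j
  simp only [sandwich, Matrix.of_apply, Matrix.smul_apply, Matrix.add_apply, Finset.smul_sum,
    smul_smul, ← Finset.sum_add_distrib, ← add_smul]
  refine Finset.sum_congr rfl fun k _ => Finset.sum_congr rfl fun l _ => ?_
  congr 1
  simp only [smul_eq_mul, star_add, star_mul', star_neg, star_one, Complex.star_def, Complex.conj_I]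
  linear_combination (α i k * (starRingEnd ℂ) (β j l) / 2 - β i k * (starRingEnd ℂ) (α j l) / 2)
    * Complex.I_sq

namespace IsNumRadSpace

theorem map_zero (h : IsNumRadSpace W) (n : ℕ) : W n 0 = 0 := by
  simpa using h.smul_eq n 0 0

theorem map_neg (h : IsNumRadSpace W) (n : ℕ) (x : Matrix (Fin n) (Fin n) X) :
    W n (-x) = W n x := by
  simpa using h.smul_eq n (-1) x

theorem nonneg (h : IsNumRadSpace W) (n : ℕ) (x : Matrix (Fin n) (Fin n) X) : 0 ≤ W n x := by
  have := h.add_le n x (-x)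
  rw [h.map_neg, add_neg_cancel, h.map_zero] at this
  linarith

theorem conj_le_of_sqBound (h : IsNumRadSpace W) {m n : ℕ} {α : Matrix (Fin n) (Fin m) ℂ} {c : ℝ}
    (hc : 0 ≤ c) (hα : SqBound α c) (x : Matrix (Fin m) (Fin m) X) :
    W n (sandwich α x α) ≤ c * W m x :=
  (h.conj_le _ _ α x).trans (mul_le_mul_of_nonneg_right (hα.opNorm_sq_le hc) (h.nonneg _ _))

theorem submatrix_le_of_injective (h : IsNumRadSpace W) {m n : ℕ} {f : Fin n → Fin m}
    (hf : Function.Injective f) (x : Matrix (Fin m) (Fin m) X) :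
    W n (x.submatrix f f) ≤ W m x := by
  have := h.conj_le_of_sqBound zero_le_one (sqBound_one_submatrix hf) x
  rw [one_mul] at this
  convert this using 2
  ext i j
  simp [sandwich, Matrix.one_apply, apply_ite, ite_smul]

theorem submatrix_le (h : IsNumRadSpace W) {m n : ℕ} (f : Fin n ≃ Fin m)
    (x : Matrix (Fin m) (Fin m) X) : W n (x.submatrix f f) ≤ W m x :=
  h.submatrix_le_of_injective f.injective x

/-- Permutation matrices are contractions with contractive inverses, so WII makes the norm
independent of the enumeration. -/
theorem eq_finNorm (h : IsNumRadSpace W) {n : ℕ} (e : ι ≃ Fin n) (x : Matrix ι ι X) :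
    W n (x.submatrix e.symm e.symm) = finNorm W x := by
  refine le_antisymm ?_ ?_
  · refine le_of_eq_of_le ?_ (h.submatrix_le (e.symm.trans (Fintype.equivFin ι)) _)
    congr 1; ext; simp
  · refine le_of_eq_of_le ?_ (h.submatrix_le ((Fintype.equivFin ι).symm.trans e) _)
    rw [finNorm]; congr 1; ext; simp

theorem finNorm_fin (h : IsNumRadSpace W) {n : ℕ} (x : Matrix (Fin n) (Fin n) X) :
    finNorm W x = W n x := by
  rw [← h.eq_finNorm (Equiv.refl _)]; rfl

theorem finNorm_submatrix (h : IsNumRadSpace W) (e : ι' ≃ ι) (x : Matrix ι ι X) :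
    finNorm W (x.submatrix e e) = finNorm W x := by
  rw [← h.eq_finNorm (Fintype.equivFin ι), ← h.eq_finNorm (e.trans (Fintype.equivFin ι))]
  congr 1; ext; simp

theorem finNorm_add_le (h : IsNumRadSpace W) (x y : Matrix ι ι X) :
    finNorm W (x + y) ≤ finNorm W x + finNorm W y := h.add_le _ _ _

theorem finNorm_smul (h : IsNumRadSpace W) (c : ℂ) (x : Matrix ι ι X) :
    finNorm W (c • x) = ‖c‖ * finNorm W x := h.smul_eq _ _ _

theorem finNorm_nonneg (h : IsNumRadSpace W) (x : Matrix ι ι X) : 0 ≤ finNorm W x := h.nonneg _ _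

theorem finNorm_zero (h : IsNumRadSpace W) : finNorm W (0 : Matrix ι ι X) = 0 := h.map_zero _

theorem eq_zero_of_finNorm (h : IsNumRadSpace W) {x : Matrix ι ι X} (hx : finNorm W x = 0) :
    x = 0 := by
  have := h.eq_zero _ _ hx
  ext i j
  simpa using congr_fun₂ this (Fintype.equivFin ι i) (Fintype.equivFin ι j)

theorem finNorm_sum_le (h : IsNumRadSpace W) {σ : Type*} (s : Finset σ) (x : σ → Matrix ι ι X) :
    finNorm W (∑ a ∈ s, x a) ≤ ∑ a ∈ s, finNorm W (x a) :=
  Finset.le_sum_of_subadditive _ h.finNorm_zero.le h.finNorm_add_le _ _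

theorem finNorm_sandwich_self_le (h : IsNumRadSpace W) {α : Matrix ι κ ℂ} {c : ℝ}
    (hc : 0 ≤ c) (hα : SqBound α c) (x : Matrix κ κ X) :
    finNorm W (sandwich α x α) ≤ c * finNorm W x := by
  refine le_of_eq_of_le ?_ (h.conj_le_of_sqBound hc
    (hα.submatrix (Fintype.equivFin ι).symm (Fintype.equivFin κ).symm) _)
  rw [finNorm]
  congr 1
  ext i j
  simp only [sandwich, Matrix.submatrix_apply, Matrix.of_apply]
  rw [← (Fintype.equivFin κ).symm.sum_comp]
  refine Finset.sum_congr rfl fun k _ => ?_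
  rw [← (Fintype.equivFin κ).symm.sum_comp]

theorem finNorm_fromBlocks (h : IsNumRadSpace W) (x : Matrix ι ι X) (y : Matrix κ κ X) :
    finNorm W (Matrix.fromBlocks x 0 0 y) = max (finNorm W x) (finNorm W y) := by
  refine (h.eq_finNorm (((Fintype.equivFin ι).sumCongr (Fintype.equivFin κ)).trans
    finSumFinEquiv) _).symm.trans (Eq.trans ?_ (h.blockDiag_eq _ _ _ _))
  congr 1
  ext i j
  obtain ⟨i, rfl⟩ := finSumFinEquiv.surjective i
  obtain ⟨j, rfl⟩ := finSumFinEquiv.surjective j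
  rcases i with i | i <;> rcases j with j | j <;> simp [blockDiag]

/-- Each of the four polarization terms is at most `2 (a + b)` times the norm of `x`, and the
prefactor is `1/4`. With `a = b = 1` the constant is the `4` that recurs below. -/
theorem finNorm_sandwich_le (h : IsNumRadSpace W) {α β : Matrix ι κ ℂ} {a b : ℝ}
    (ha : 0 ≤ a) (hb : 0 ≤ b) (hα : SqBound α a) (hβ : SqBound β b) (x : Matrix κ κ X) :
    finNorm W (sandwich α x β) ≤ 2 * (a + b) * finNorm W x := by
  have hz : ∀ z : ℂ, ‖z‖ = 1 →
      finNorm W (sandwich (α + z • β) x (α + z • β)) ≤ 2 * (a + b) * finNorm W x := fun z hz => by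
    have := hβ.smul z
    rw [hz, one_pow, one_mul] at this
    exact h.finNorm_sandwich_self_le (by positivity) (hα.add this) x
  rw [sandwich_polarization, h.finNorm_smul]
  have h1 := hz 1 (by simp)
  have h2 := hz (-1) (by simp)
  have h3 := hz Complex.I (by simp)
  have h4 := hz (-Complex.I) (by simp)
  rw [one_smul] at h1
  have := (h.finNorm_add_le (sandwich (α + β) x (α + β) + (-1 : ℂ) •
      sandwich (α + (-1 : ℂ) • β) x (α + (-1 : ℂ) • β) + Complex.I •
      sandwich (α + Complex.I • β) x (α + Complex.I • β)) ((-Complex.I) •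
      sandwich (α + (-Complex.I) • β) x (α + (-Complex.I) • β))).trans (add_le_add
        ((h.finNorm_add_le _ _).trans (add_le_add (h.finNorm_add_le _ _) le_rfl)) le_rfl)
  simp only [h.finNorm_smul, norm_neg, norm_one, Complex.norm_I, one_mul] at this
  rw [norm_inv, Complex.norm_ofNat]
  linarith

end IsNumRadSpace
end Norms

/-! ### The space of completely bounded maps. -/

section CompletelyBounded

variable {X : Type*} [AddCommGroup X] [Module ℂ X] {Y : Type*} [AddCommGroup Y] [Module ℂ Y]
variable {WX : MatrixNorms X} {WY : MatrixNorms Y}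

/-- Rescaling to the unit ball. Of the target only homogeneity is needed, so the criterion applies
to `matNorms` without checking the other axioms there. -/
theorem cbNorm_le_iff (hX : IsNumRadSpace WX)
    (hs : ∀ (n : ℕ) (c : ℂ) (y : Matrix (Fin n) (Fin n) Y), WY n (c • y) = ‖c‖ * WY n y)
    (φ : X →ₗ[ℂ] Y) {c : ℝ} (hc : 0 ≤ c) :
    cbNorm WX WY φ ≤ ENNReal.ofReal c ↔
      ∀ (n : ℕ) (x : Matrix (Fin n) (Fin n) X), WY n (x.map φ) ≤ c * WX n x := by
  simp only [cbNorm, iSup_le_iff]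
  refine forall_congr' fun n => ⟨fun h x => ?_, fun h x hx => ?_⟩
  · by_cases h0 : WX n x = 0
    · rw [hX.eq_zero n x h0]
      have h1 : (0 : Matrix (Fin n) (Fin n) X).map φ = 0 := by ext; simp
      have h2 : WY n 0 = 0 := by simpa using hs n 0 0
      rw [h1, h2, hX.map_zero, mul_zero]
    · have hn : ‖(((WX n x)⁻¹ : ℝ) : ℂ)‖ = (WX n x)⁻¹ := by
        simp [abs_of_nonneg (hX.nonneg n x)]
      have h1 := h ((((WX n x)⁻¹ : ℝ) : ℂ) • x) (by
        rw [hX.smul_eq, hn, inv_mul_cancel₀ h0])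
      rw [ENNReal.ofReal_le_ofReal_iff hc] at h1
      have h2 : ((((WX n x)⁻¹ : ℝ) : ℂ) • x).map φ = (((WX n x)⁻¹ : ℝ) : ℂ) • x.map φ := by
        ext i j
        exact φ.map_smul _ _
      rw [h2, hs, hn, inv_mul_le_iff₀ (lt_of_le_of_ne (hX.nonneg n x) (Ne.symm h0))] at h1
      linarith
  · refine ENNReal.ofReal_le_ofReal ((h x).trans ?_)
    exact mul_le_of_le_one_right hc hx

theorem cbNorm_lt_top_iff (hX : IsNumRadSpace WX)
    (hs : ∀ (n : ℕ) (c : ℂ) (y : Matrix (Fin n) (Fin n) Y), WY n (c • y) = ‖c‖ * WY n y)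
    (φ : X →ₗ[ℂ] Y) :
    cbNorm WX WY φ < ∞ ↔ ∃ c : ℝ, 0 ≤ c ∧
      ∀ (n : ℕ) (x : Matrix (Fin n) (Fin n) X), WY n (x.map φ) ≤ c * WX n x := by
  refine ⟨fun h => ⟨(cbNorm WX WY φ).toReal, ENNReal.toReal_nonneg, ?_⟩, ?_⟩
  · rw [← cbNorm_le_iff hX hs φ ENNReal.toReal_nonneg, ENNReal.ofReal_toReal h.ne]
  · rintro ⟨c, hc, h⟩
    exact ((cbNorm_le_iff hX hs φ hc).2 h).trans_lt ENNReal.ofReal_lt_top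

/-- The matrix `[φ_ij x_ab]`, indexed by the pairs `(a, i)`. -/
def amp {κ ν : Type*} (φ : Matrix ν ν (X →ₗ[ℂ] Y)) (x : Matrix κ κ X) :
    Matrix (κ × ν) (κ × ν) Y :=
  Matrix.of fun p q => φ p.2 q.2 (x p.1 q.1)

theorem matNorms_map (hY : IsNumRadSpace WY) {n k : ℕ}
    (φ : Matrix (Fin n) (Fin n) (X →ₗ[ℂ] Y)) (x : Matrix (Fin k) (Fin k) X) :
    matNorms WY n k (x.map (toMatrixMap φ)) = finNorm WY (amp φ x) := by
  rw [← hY.eq_finNorm finProdFinEquiv]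
  rfl

theorem matNorms_smul (hY : IsNumRadSpace WY) (n k : ℕ) (c : ℂ)
    (A : Matrix (Fin k) (Fin k) (Matrix (Fin n) (Fin n) Y)) :
    matNorms WY n k (c • A) = ‖c‖ * matNorms WY n k A :=
  hY.smul_eq _ _ _

/-- The amplification of the matrix is the sum of its entries' amplifications placed in their slots
by `1 ⊗ e_i` and `1 ⊗ e_j`; conversely the transposed slots cut out each entry. Both operations are
bounded with constant `4`. -/
theorem forall_mem_WCB_iff (hX : IsNumRadSpace WX) (hY : IsNumRadSpace WY) (n : ℕ)
    (φ : Matrix (Fin n) (Fin n) (X →ₗ[ℂ] Y)) :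
    (∀ i j, φ i j ∈ WCB WX WY hY) ↔ cbNorm WX (matNorms WY n) (toMatrixMap φ) < ∞ := by
  rw [cbNorm_lt_top_iff hX (matNorms_smul hY n)]
  simp only [matNorms_map hY]
  constructor
  · intro h
    have h' : ∀ i j, ∃ c : ℝ, 0 ≤ c ∧
      ∀ (k : ℕ) (x : Matrix (Fin k) (Fin k) X), WY k (x.map (φ i j)) ≤ c * WX k x := fun i j =>
        (cbNorm_lt_top_iff hX hY.smul_eq _).1 (h i j)
    choose c hc hle using h'
    refine ⟨∑ i, ∑ j, 4 * c i j, Finset.sum_nonneg fun i _ => Finset.sum_nonneg fun j _ =>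
      mul_nonneg (by norm_num) (hc i j), fun k x => ?_⟩
    have e : amp φ x = ∑ i, ∑ j, sandwich (slot (Fin k) i) (x.map (φ i j)) (slot (Fin k) j) := by
      ext ⟨a, i⟩ ⟨b, j⟩
      rw [Matrix.sum_apply, Finset.sum_eq_single i, Matrix.sum_apply, Finset.sum_eq_single j]
      · simp only [amp, sandwich, slot, Matrix.of_apply]
        rw [Finset.sum_eq_single a, Finset.sum_eq_single b]
        · simp
        · intro l _ hl; simp [Ne.symm hl]
        · simp
        · intro l _ hl; simp [Ne.symm hl]
        · simp
      · intro l _ hl; simp [sandwich, slot, Ne.symm hl]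
      · simp
      · intro l _ hl
        rw [Matrix.sum_apply]
        simp [sandwich, slot, Ne.symm hl]
      · simp
    rw [e, Finset.sum_mul]
    refine (hY.finNorm_sum_le _ _).trans (Finset.sum_le_sum fun i _ => ?_)
    rw [Finset.sum_mul]
    refine (hY.finNorm_sum_le _ _).trans (Finset.sum_le_sum fun j _ => ?_)
    refine (hY.finNorm_sandwich_le zero_le_one zero_le_one (sqBound_slot _ i)
      (sqBound_slot _ j) _).trans ?_
    rw [hY.finNorm_fin]
    linarith [hle i j k x]
  · rintro ⟨c, hc, h⟩ i j
    refine (cbNorm_lt_top_iff hX hY.smul_eq _).2 ⟨4 * c, by positivity, fun k x => ?_⟩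
    have e : x.map (φ i j) = sandwich (slot (Fin k) i)ᵀ (amp φ x) (slot (Fin k) j)ᵀ := by
      ext a b
      simp only [amp, sandwich, slot, Matrix.of_apply, Matrix.transpose_apply, Matrix.map_apply]
      rw [Finset.sum_eq_single (a, i), Finset.sum_eq_single (b, j)]
      · simp
      · rintro ⟨l, l'⟩ _ hl
        have : ¬ (l = b ∧ l' = j) := by simpa using hl
        simp [this]
      · simp
      · rintro ⟨l, l'⟩ _ hl
        have : ¬ (l = a ∧ l' = i) := by simpa using hl
        simp [this]
      · simp
    rw [e, ← hY.finNorm_fin]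
    refine (hY.finNorm_sandwich_le zero_le_one zero_le_one (sqBound_slot_transpose _ i)
      (sqBound_slot_transpose _ j) _).trans ?_
    linarith [h k x]

/-- The matrix of linear maps underlying a matrix over `WCB X Y`. -/
abbrev unbundle {hY : IsNumRadSpace WY} {n : ℕ} (φ : Matrix (Fin n) (Fin n) (WCB WX WY hY)) :
    Matrix (Fin n) (Fin n) (X →ₗ[ℂ] Y) :=
  φ.map fun f => (f : X →ₗ[ℂ] Y)

theorem cbNorm_toMatrixMap_lt_top (hX : IsNumRadSpace WX) (hY : IsNumRadSpace WY)
    {n : ℕ} (φ : Matrix (Fin n) (Fin n) (WCB WX WY hY)) :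
    cbNorm WX (matNorms WY n) (toMatrixMap (unbundle φ)) < ∞ :=
  (forall_mem_WCB_iff hX hY n _).1 fun i j => (φ i j).2

theorem wcbNorms_nonneg {hY : IsNumRadSpace WY} {n : ℕ}
    (φ : Matrix (Fin n) (Fin n) (WCB WX WY hY)) : 0 ≤ wcbNorms WX WY hY n φ :=
  ENNReal.toReal_nonneg

theorem wcbNorms_le_iff (hX : IsNumRadSpace WX) (hY : IsNumRadSpace WY)
    {n : ℕ} (φ : Matrix (Fin n) (Fin n) (WCB WX WY hY)) {c : ℝ}
    (hc : 0 ≤ c) : wcbNorms WX WY hY n φ ≤ c ↔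
      ∀ (k : ℕ) (x : Matrix (Fin k) (Fin k) X),
        finNorm WY (amp (unbundle φ) x) ≤ c * WX k x := by
  rw [wcbNorms, ← ENNReal.le_ofReal_iff_toReal_le (cbNorm_toMatrixMap_lt_top hX hY φ).ne hc,
    cbNorm_le_iff hX (matNorms_smul hY n) _ hc]
  simp only [matNorms_map hY]

theorem finNorm_amp_le (hX : IsNumRadSpace WX) (hY : IsNumRadSpace WY) {n : ℕ}
    (φ : Matrix (Fin n) (Fin n) (WCB WX WY hY)) {k : ℕ} (x : Matrix (Fin k) (Fin k) X) :
    finNorm WY (amp (unbundle φ) x) ≤ wcbNorms WX WY hY n φ * WX k x :=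
  (wcbNorms_le_iff hX hY φ (wcbNorms_nonneg _)).1 le_rfl k x

/-- Distributing the product of index sets over the sum turns the amplification of a block sum into
a block sum, where WI in `Y` applies. -/
theorem amp_blockDiag {hY : IsNumRadSpace WY} {m n k : ℕ}
    (φ : Matrix (Fin m) (Fin m) (WCB WX WY hY)) (ψ : Matrix (Fin n) (Fin n) (WCB WX WY hY))
    (x : Matrix (Fin k) (Fin k) X) :
    amp (unbundle (blockDiag φ ψ)) x =
      (Matrix.fromBlocks (amp (unbundle φ) x) 0 0 (amp (unbundle ψ) x)).submatrix
        (((Equiv.refl _).prodCongr finSumFinEquiv.symm).trans (Equiv.prodSumDistrib _ _ _))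
        (((Equiv.refl _).prodCongr finSumFinEquiv.symm).trans (Equiv.prodSumDistrib _ _ _)) := by
  ext ⟨a, i⟩ ⟨b, j⟩
  obtain ⟨i, rfl⟩ := finSumFinEquiv.surjective i
  obtain ⟨j, rfl⟩ := finSumFinEquiv.surjective j
  rcases i with i | i <;> rcases j with j | j <;> simp [blockDiag, amp]

theorem amp_conj {hY : IsNumRadSpace WY} {m n k : ℕ} (α : Matrix (Fin n) (Fin m) ℂ)
    (φ : Matrix (Fin m) (Fin m) (WCB WX WY hY)) (x : Matrix (Fin k) (Fin k) X) :
    amp (unbundle (conj α φ)) x =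
      sandwich (Matrix.of fun (p : Fin k × Fin n) (q : Fin k × Fin m) =>
          if p.1 = q.1 then α p.2 q.2 else 0) (amp (unbundle φ) x)
        (Matrix.of fun (p : Fin k × Fin n) (q : Fin k × Fin m) =>
          if p.1 = q.1 then α p.2 q.2 else 0) := by
  ext ⟨a, i⟩ ⟨b, j⟩
  simp only [amp, sandwich, conj, Matrix.of_apply, Matrix.map_apply]
  rw [Fintype.sum_prod_type, Finset.sum_eq_single a]
  · simp only [Fintype.sum_prod_type]
    rw [Submodule.coe_sum, LinearMap.sum_apply]
    refine Finset.sum_congr rfl fun p _ => ?_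
    rw [Finset.sum_eq_single b]
    · rw [Submodule.coe_sum, LinearMap.sum_apply]
      simp
    · intro c _ hc
      simp [Ne.symm hc]
    · simp
  · intro c _ hc
    simp [Ne.symm hc]
  · simp

/-- `WCB(X, Y)` is a numerical radius operator space. -/
theorem isNumRadSpace_wcbNorms (hX : IsNumRadSpace WX) (hY : IsNumRadSpace WY) :
    IsNumRadSpace (wcbNorms WX WY hY) where
  add_le n φ ψ := by
    rw [wcbNorms_le_iff hX hY _ (add_nonneg (wcbNorms_nonneg _) (wcbNorms_nonneg _))]
    intro k x
    have e : amp (unbundle (φ + ψ)) x = amp (unbundle φ) x + amp (unbundle ψ) x := by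
      ext; simp [amp]
    rw [e, add_mul]
    exact (hY.finNorm_add_le _ _).trans
      (add_le_add (finNorm_amp_le hX hY φ x) (finNorm_amp_le hX hY ψ x))
  smul_eq n c φ := by
    have h : ∀ (c : ℂ) (φ : Matrix (Fin n) (Fin n) (WCB WX WY hY)),
        wcbNorms WX WY hY n (c • φ) ≤ ‖c‖ * wcbNorms WX WY hY n φ := fun c φ => by
      rw [wcbNorms_le_iff hX hY _ (mul_nonneg (norm_nonneg c) (wcbNorms_nonneg _))]
      intro k x
      have e : amp (unbundle (c • φ)) x = c • amp (unbundle φ) x := by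
        ext; simp [amp]
      rw [e, hY.finNorm_smul, mul_assoc]
      exact mul_le_mul_of_nonneg_left (finNorm_amp_le hX hY φ x) (norm_nonneg c)
    refine le_antisymm (h c φ) ?_
    by_cases hc : c = 0
    · rw [hc, norm_zero, zero_mul]
      exact wcbNorms_nonneg _
    · have := h c⁻¹ (c • φ)
      rwa [inv_smul_smul₀ hc, norm_inv, ← div_eq_inv_mul,
        le_div_iff₀' (norm_pos_iff.2 hc)] at this
  eq_zero n φ h := by
    ext i j x
    -- Level one already separates: a `1 × 1` matrix `[x]` exhibits every value `φ_ij x`.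
    have h1 := finNorm_amp_le hX hY φ (Matrix.of fun (_ : Fin 1) (_ : Fin 1) => x)
    rw [h, zero_mul] at h1
    have h2 := hY.eq_zero_of_finNorm (le_antisymm h1 (hY.finNorm_nonneg _))
    simpa [amp] using congr_fun₂ h2 (0, i) (0, j)
  blockDiag_eq m n φ ψ := by
    refine le_antisymm ?_ (max_le ?_ ?_)
    · rw [wcbNorms_le_iff hX hY _ (le_max_of_le_left (wcbNorms_nonneg _))]
      intro k x
      rw [amp_blockDiag, hY.finNorm_submatrix, hY.finNorm_fromBlocks]
      exact max_le ((finNorm_amp_le hX hY φ x).trans (mul_le_mul_of_nonneg_right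
        (le_max_left _ _) (hX.nonneg _ _))) ((finNorm_amp_le hX hY ψ x).trans
        (mul_le_mul_of_nonneg_right (le_max_right _ _) (hX.nonneg _ _)))
    · rw [wcbNorms_le_iff hX hY _ (wcbNorms_nonneg _)]
      intro k x
      have := finNorm_amp_le hX hY (blockDiag φ ψ) x
      rw [amp_blockDiag, hY.finNorm_submatrix, hY.finNorm_fromBlocks] at this
      exact (le_max_left _ _).trans this
    · rw [wcbNorms_le_iff hX hY _ (wcbNorms_nonneg _)]
      intro k x
      have := finNorm_amp_le hX hY (blockDiag φ ψ) x
      rw [amp_blockDiag, hY.finNorm_submatrix, hY.finNorm_fromBlocks] at this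
      exact (le_max_right _ _).trans this
  conj_le m n α φ := by
    rw [wcbNorms_le_iff hX hY _ (mul_nonneg (sq_nonneg _) (wcbNorms_nonneg _))]
    intro k x
    rw [amp_conj, mul_assoc]
    exact (hY.finNorm_sandwich_self_le (sq_nonneg _) (sqBound_opNorm α).one_kronecker _).trans
      (mul_le_mul_of_nonneg_left (finNorm_amp_le hX hY φ x) (sq_nonneg _))

end CompletelyBounded

/-! ### Quotients by closed subspaces. -/

section Quotient

variable {X : Type*} [AddCommGroup X] [Module ℂ X] {W : MatrixNorms X}

theorem exists_map_mkQ_eq (N : Submodule ℂ X) {n : ℕ} (A : Matrix (Fin n) (Fin n) (X ⧸ N)) :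
    ∃ x : Matrix (Fin n) (Fin n) X, x.map N.mkQ = A := by
  choose f hf using N.mkQ_surjective
  exact ⟨A.map f, by ext; simp [hf]⟩

theorem quotNorms_le (h : IsNumRadSpace W) (N : Submodule ℂ X) {n : ℕ}
    (x : Matrix (Fin n) (Fin n) X) : quotNorms W N n (x.map N.mkQ) ≤ W n x := by
  refine ciInf_le (f := fun y : {y : Matrix (Fin n) (Fin n) X // y.map N.mkQ = x.map N.mkQ} =>
    W n y) ⟨0, ?_⟩ ⟨x, rfl⟩
  rintro _ ⟨y, rfl⟩
  exact h.nonneg _ _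

theorem le_quotNorms (N : Submodule ℂ X) {n : ℕ} (A : Matrix (Fin n) (Fin n) (X ⧸ N)) {c : ℝ}
    (hc : ∀ x : Matrix (Fin n) (Fin n) X, x.map N.mkQ = A → c ≤ W n x) :
    c ≤ quotNorms W N n A := by
  have : Nonempty {x : Matrix (Fin n) (Fin n) X // x.map N.mkQ = A} :=
    let ⟨x, hx⟩ := exists_map_mkQ_eq N A; ⟨⟨x, hx⟩⟩
  exact le_ciInf fun x => hc x x.2

theorem exists_lt_of_quotNorms_lt (N : Submodule ℂ X) {n : ℕ}
    {A : Matrix (Fin n) (Fin n) (X ⧸ N)} {c : ℝ} (hc : quotNorms W N n A < c) :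
    ∃ x : Matrix (Fin n) (Fin n) X, x.map N.mkQ = A ∧ W n x < c := by
  by_contra! h
  exact absurd (le_quotNorms N A h) (not_le.2 hc)

/-- An entry is `e_i x e_j*` for unit rows. This is what links closedness for `W 1` to the norms at
higher levels. -/
theorem IsNumRadSpace.entry_le (h : IsNumRadSpace W) {n : ℕ} (x : Matrix (Fin n) (Fin n) X)
    (i j : Fin n) : W 1 (Matrix.of fun _ _ => x i j) ≤ 4 * W n x := by
  have hr : ∀ i : Fin n, SqBound (Matrix.of fun (_ : Fin 1) j => (Pi.single i 1 : Fin n → ℂ) j) 1 :=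
    fun i => by
      have := sqBound_row (Pi.single i 1 : Fin n → ℂ)
      rwa [Finset.sum_eq_single i (by intro j _ hj; simp [hj]) (by simp), Pi.single_eq_same,
        norm_one, one_pow] at this
  have := h.finNorm_sandwich_le zero_le_one zero_le_one (hr i) (hr j) x
  rw [h.finNorm_fin, h.finNorm_fin] at this
  refine le_of_eq_of_le (congrArg _ ?_) (this.trans_eq (by ring))
  ext a b
  simp [sandwich, Pi.single_apply, apply_ite, ite_smul]

theorem isNumRadSpace_quotNorms (h : IsNumRadSpace W) {N : Submodule ℂ X}
    (hN : IsClosedSubspace W N) : IsNumRadSpace (quotNorms W N) where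
  add_le n A B := by
    refine le_of_forall_pos_lt_add fun ε hε => ?_
    obtain ⟨x, rfl, hx⟩ := exists_lt_of_quotNorms_lt N
      (lt_add_of_pos_right (quotNorms W N n A) (half_pos hε))
    obtain ⟨y, rfl, hy⟩ := exists_lt_of_quotNorms_lt N
      (lt_add_of_pos_right (quotNorms W N n B) (half_pos hε))
    have e : x.map N.mkQ + y.map N.mkQ = (x + y).map N.mkQ := by ext; simp
    rw [e] at *
    linarith [quotNorms_le h N (x + y), h.add_le n x y]
  smul_eq n c A := by
    have hle : ∀ (c : ℂ) (A : Matrix (Fin n) (Fin n) (X ⧸ N)), c ≠ 0 →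
        ‖c‖ * quotNorms W N n A ≤ quotNorms W N n (c • A) := fun c A hc => by
      refine le_quotNorms N _ fun x hx => ?_
      have e : A = (c⁻¹ • x).map N.mkQ := by
        rw [← inv_smul_smul₀ hc A, ← hx]; ext; simp
      have := quotNorms_le h N (c⁻¹ • x)
      rw [← e, h.smul_eq, norm_inv, inv_mul_eq_div, le_div_iff₀' (norm_pos_iff.2 hc)] at this
      exact this
    by_cases hc : c = 0
    · subst hc
      refine le_antisymm ?_ ?_
      · have := quotNorms_le h N (0 : Matrix (Fin n) (Fin n) X)
        rw [h.map_zero] at this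
        refine le_of_eq_of_le ?_ (this.trans_eq (by simp))
        congr 1; ext; simp
      · rw [norm_zero, zero_mul]
        exact le_quotNorms N _ fun x _ => h.nonneg _ _
    · refine le_antisymm ?_ (hle c A hc)
      have := hle c⁻¹ (c • A) (inv_ne_zero hc)
      rwa [inv_smul_smul₀ hc, norm_inv, inv_mul_eq_div, div_le_iff₀' (norm_pos_iff.2 hc)] at this
  eq_zero n A hA := by
    obtain ⟨x, rfl⟩ := exists_map_mkQ_eq N A
    ext i j
    simp only [Matrix.map_apply, Matrix.zero_apply, Submodule.mkQ_apply,
      Submodule.Quotient.mk_eq_zero]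
    refine hN _ fun ε hε => ?_
    -- A small representative `y` of the same class puts `x i j - y i j` in `N` within `4 * (ε / 4)`
    -- of `x i j`, so closedness applies.
    obtain ⟨y, hy, hlt⟩ := exists_lt_of_quotNorms_lt N
      (hA.trans_lt (by positivity : 0 < ε / 4))
    refine ⟨x i j - y i j, ?_, ?_⟩
    · rw [← Submodule.Quotient.mk_eq_zero, Submodule.Quotient.mk_sub, sub_eq_zero]
      exact (congr_fun₂ hy i j).symm
    · rw [sub_sub_cancel]
      linarith [h.entry_le y i j]
  blockDiag_eq m n A B := by
    refine le_antisymm ?_ ?_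
    · refine le_of_forall_pos_lt_add fun ε hε => ?_
      obtain ⟨x, hx, hx'⟩ := exists_lt_of_quotNorms_lt N
        (lt_add_of_pos_right (quotNorms W N m A) hε)
      obtain ⟨y, hy, hy'⟩ := exists_lt_of_quotNorms_lt N
        (lt_add_of_pos_right (quotNorms W N n B) hε)
      have e : (blockDiag x y).map N.mkQ = blockDiag A B := by
        rw [← hx, ← hy]
        ext i j
        obtain ⟨i, rfl⟩ := finSumFinEquiv.surjective i
        obtain ⟨j, rfl⟩ := finSumFinEquiv.surjective j
        rcases i with i | i <;> rcases j with j | j <;> simp [blockDiag]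
      have := quotNorms_le h N (blockDiag x y)
      rw [e, h.blockDiag_eq] at this
      refine this.trans_lt ?_
      rw [← max_add_add_right]
      exact max_lt_max hx' hy'
    · refine le_quotNorms N _ fun z hz => ?_
      -- A representative of the block sum need not be block diagonal; its diagonal corners
      -- represent the blocks and have no larger norm.
      have key : ∀ (k : ℕ) (f : Fin k → Fin (m + n)) (_ : Function.Injective f),
          quotNorms W N k ((blockDiag A B).submatrix f f) ≤ W (m + n) z := fun k f hf => by
        have e : (blockDiag A B).submatrix f f = (z.submatrix f f).map N.mkQ := by
          rw [← hz]; rfl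
        rw [e]
        refine (quotNorms_le h N _).trans ?_
        exact h.submatrix_le_of_injective hf z
      refine max_le ?_ ?_
      · refine le_of_eq_of_le ?_ (key m (Fin.castAdd n) (Fin.castAdd_injective m n))
        congr 1; ext i j; simp [blockDiag]
      · refine le_of_eq_of_le ?_ (key n (Fin.natAdd m) (Fin.natAdd_injective n m))
        congr 1; ext i j; simp [blockDiag]
  conj_le m n α A := by
    refine le_of_forall_pos_lt_add fun ε hε => ?_
    -- The added `1` keeps the tolerance `ε / (opNorm α ^ 2 + 1)` meaningful when `α = 0`.
    have hc : 0 < opNorm α ^ 2 + 1 := by positivity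
    obtain ⟨x, rfl, hx⟩ := exists_lt_of_quotNorms_lt N
      (lt_add_of_pos_right (quotNorms W N m A) (div_pos hε hc))
    have e : conj α (x.map N.mkQ) = (conj α x).map N.mkQ := by
      ext i j; simp [conj]
    rw [e] at *
    have h1 := quotNorms_le h N (conj α x)
    have h2 := h.conj_le m n α x
    have h3 := mul_le_mul_of_nonneg_left hx.le (sq_nonneg (opNorm α))
    have h4 : opNorm α ^ 2 * (ε / (opNorm α ^ 2 + 1)) < ε := by
      rw [mul_div_assoc', div_lt_iff₀ hc]; nlinarith
    linarith [mul_add (opNorm α ^ 2) (quotNorms W N m (x.map N.mkQ)) (ε / (opNorm α ^ 2 + 1))]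

end Quotient

/-! ### The numerical radius through quadratic forms. -/

/-- The quadratic form `(a ξ | ξ)` of a complex matrix. -/
def qform {ι : Type*} [Fintype ι] (a : Matrix ι ι ℂ) (ξ : ι → ℂ) : ℂ :=
  ∑ i, ∑ j, a i j * ξ j * star (ξ i)

section Qform

variable {ι κ : Type*} [Fintype ι] [Fintype κ]

theorem qform_add (a b : Matrix ι ι ℂ) (ξ : ι → ℂ) : qform (a + b) ξ = qform a ξ + qform b ξ := by
  simp [qform, add_mul, Finset.sum_add_distrib]

theorem qform_smul (c : ℂ) (a : Matrix ι ι ℂ) (ξ : ι → ℂ) :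
    qform (c • a) ξ = c * qform a ξ := by
  simp [qform, Finset.mul_sum, mul_assoc]

theorem qform_one [DecidableEq ι] (ξ : ι → ℂ) :
    qform 1 ξ = ((∑ i, ‖ξ i‖ ^ 2 : ℝ) : ℂ) := by
  simp [qform, Matrix.one_apply, Complex.mul_conj']

theorem qform_mul_conjTranspose (α : Matrix ι κ ℂ) (ξ : ι → ℂ) :
    qform (α * αᴴ) ξ = ((∑ j, ‖∑ i, star (α i j) * ξ i‖ ^ 2 : ℝ) : ℂ) := by
  push_cast
  simp only [qform, Matrix.mul_apply, Matrix.conjTranspose_apply, ← Complex.mul_conj', map_sum,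
    map_mul, Finset.sum_mul, Finset.mul_sum]
  rw [Finset.sum_comm]
  simp_rw [Finset.sum_comm (s := Finset.univ (α := ι)) (t := Finset.univ (α := κ))]
  refine Finset.sum_congr rfl fun _ _ => ?_
  rw [Finset.sum_comm]
  refine Finset.sum_congr rfl fun _ _ => Finset.sum_congr rfl fun _ _ => ?_
  simp
  ring

theorem qform_submatrix (a : Matrix ι ι ℂ) (e : κ ≃ ι) (ξ : κ → ℂ) :
    qform (a.submatrix e e) ξ = qform a (ξ ∘ e.symm) := by
  simp [qform, ← e.sum_comp]

theorem norm_qform_le {n : ℕ} (a : Matrix (Fin n) (Fin n) ℂ) (ξ : Fin n → ℂ) :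
    ‖qform a ξ‖ ≤ numRadius n a * ∑ i, ‖ξ i‖ ^ 2 := by
  have := inner_le_numRadius a (WithLp.toLp 2 ξ)
  rwa [inner_toEuclideanLin, EuclideanSpace.norm_sq_eq] at this

theorem numRadius_le_iff {n : ℕ} (a : Matrix (Fin n) (Fin n) ℂ) {c : ℝ} (hc : 0 ≤ c) :
    numRadius n a ≤ c ↔ ∀ ξ : Fin n → ℂ, ‖qform a ξ‖ ≤ c * ∑ i, ‖ξ i‖ ^ 2 := by
  refine ⟨fun h ξ => (norm_qform_le a ξ).trans (by gcongr), fun h => Real.iSup_le ?_ hc⟩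
  rintro ⟨ξ, hξ⟩
  have := h ξ
  rw [← EuclideanSpace.norm_sq_eq, hξ, one_pow, mul_one] at this
  dsimp only
  rwa [inner_toEuclideanLin]

theorem finNorm_numRadius_le_iff (a : Matrix ι ι ℂ) {c : ℝ} (hc : 0 ≤ c) :
    finNorm numRadius a ≤ c ↔ ∀ ξ : ι → ℂ, ‖qform a ξ‖ ≤ c * ∑ i, ‖ξ i‖ ^ 2 := by
  rw [finNorm, numRadius_le_iff _ hc]
  refine ⟨fun h ξ => ?_, fun h ξ => ?_⟩
  · have := h (ξ ∘ (Fintype.equivFin ι).symm)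
    rw [qform_submatrix] at this
    have e := (Fintype.equivFin ι).symm.sum_comp fun i => ‖ξ i‖ ^ 2
    simp only [Function.comp_def, Equiv.symm_symm, Equiv.symm_apply_apply] at this
    rwa [e] at this
  · rw [qform_submatrix]
    have e := (Fintype.equivFin ι).sum_comp fun i => ‖ξ i‖ ^ 2
    rw [← e]
    exact h _

theorem norm_qform_le_finNorm (a : Matrix ι ι ℂ) (ξ : ι → ℂ) :
    ‖qform a ξ‖ ≤ finNorm numRadius a * ∑ i, ‖ξ i‖ ^ 2 :=
  (finNorm_numRadius_le_iff a (numRadius_nonneg _ _)).1 le_rfl ξ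

end Qform

/-! ### The Hahn-Banach argument. -/

section Domination

variable {X : Type*} [AddCommGroup X] [Module ℂ X] {W : MatrixNorms X}

theorem sandwich_fromCols {ι κ κ' : Type*} [Fintype κ] [Fintype κ'] (α : Matrix ι κ ℂ)
    (β : Matrix ι κ' ℂ) (x : Matrix κ κ X) (y : Matrix κ' κ' X) :
    sandwich (Matrix.fromCols α β) (Matrix.fromBlocks x 0 0 y) (Matrix.fromCols α β) =
      sandwich α x α + sandwich β y β := by
  ext i j
  simp [sandwich, Fintype.sum_sum_type]

theorem sandwich_submatrix {ι κ κ' : Type*} [Fintype κ] [Fintype κ'] (α : Matrix ι κ ℂ)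
    (x : Matrix κ κ X) (e : κ' ≃ κ) :
    sandwich (α.submatrix id e) (x.submatrix e e) (α.submatrix id e) = sandwich α x α := by
  ext i j
  simp only [sandwich, Matrix.of_apply, Matrix.submatrix_apply, id]
  rw [← e.sum_comp]
  refine Finset.sum_congr rfl fun k _ => ?_
  rw [← e.sum_comp]

/-- The row `[α β]` merges two terms into one, and its product with its adjoint is `α α* + β β*`.
Together with WI this makes `dominationCone` closed under addition. -/
theorem conj_blockDiag {m₁ m₂ n : ℕ} (α : Matrix (Fin n) (Fin m₁) ℂ)
    (β : Matrix (Fin n) (Fin m₂) ℂ) (x : Matrix (Fin m₁) (Fin m₁) X)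
    (y : Matrix (Fin m₂) (Fin m₂) X) :
    conj ((Matrix.fromCols α β).submatrix id finSumFinEquiv.symm) (blockDiag x y) =
      conj α x + conj β y :=
  (sandwich_submatrix _ _ finSumFinEquiv.symm).trans (sandwich_fromCols α β x y)

theorem conj_smul {m n : ℕ} (c : ℂ) (α : Matrix (Fin n) (Fin m) ℂ)
    (x : Matrix (Fin m) (Fin m) X) : conj (c • α) x = (c * star c) • conj α x := by
  ext i j
  simp only [conj, Matrix.of_apply, Matrix.smul_apply, Finset.smul_sum, smul_smul]
  refine Finset.sum_congr rfl fun _ _ => Finset.sum_congr rfl fun _ _ => ?_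
  congr 1
  simp
  ring

/-- The cone of all pairs `(y, B)` with `y = α x α*`, `W x ≤ 1` and `α α* ≤ Re B`. -/
def dominationCone (h : IsNumRadSpace W) (n : ℕ) :
    PointedCone ℝ (Matrix (Fin n) (Fin n) X × Matrix (Fin n) (Fin n) ℂ) where
  carrier := {q | ∃ (m : ℕ) (α : Matrix (Fin n) (Fin m) ℂ) (x : Matrix (Fin m) (Fin m) X),
    W m x ≤ 1 ∧ conj α x = q.1 ∧ ∀ ξ, ∑ j, ‖∑ i, star (α i j) * ξ i‖ ^ 2 ≤ (qform q.2 ξ).re}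
  zero_mem' := by
    refine ⟨0, 0, 0, by rw [h.map_zero]; exact zero_le_one, ?_, fun ξ => ?_⟩
    · ext; simp [conj]
    · simp [qform]
  add_mem' := by
    rintro ⟨y, B⟩ ⟨z, C⟩ ⟨m₁, α, x, hx, rfl, hB⟩ ⟨m₂, β, x', hx', rfl, hC⟩
    refine ⟨m₁ + m₂, (Matrix.fromCols α β).submatrix id finSumFinEquiv.symm, blockDiag x x',
      ?_, conj_blockDiag _ _ _ _, fun ξ => ?_⟩
    · rw [h.blockDiag_eq]
      exact max_le hx hx'
    · have := add_le_add (hB ξ) (hC ξ)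
      rw [Prod.snd_add, qform_add, Complex.add_re, ← finSumFinEquiv.sum_comp,
        Fintype.sum_sum_type]
      simpa using this
  smul_mem' := by
    rintro ⟨c, hc⟩ ⟨y, B⟩ ⟨m, α, x, hx, rfl, hB⟩
    have hs : ((Real.sqrt c : ℝ) : ℂ) * star ((Real.sqrt c : ℝ) : ℂ) = (c : ℂ) := by
      rw [Complex.star_def, Complex.conj_ofReal, ← Complex.ofReal_mul, Real.mul_self_sqrt hc]
    refine ⟨m, ((Real.sqrt c : ℝ) : ℂ) • α, x, hx, ?_, fun ξ => ?_⟩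
    · rw [conj_smul, hs]
      ext i j
      exact Complex.coe_smul c _
    · have e : ((⟨c, hc⟩ : {c : ℝ // 0 ≤ c}) • B : Matrix (Fin n) (Fin n) ℂ) = (c : ℂ) • B := by
        ext i j
        exact (Complex.coe_smul c _).symm
      have e2 : ∀ j, ∑ i, star ((((Real.sqrt c : ℝ) : ℂ) • α) i j) * ξ i =
          ((Real.sqrt c : ℝ) : ℂ) * ∑ i, star (α i j) * ξ i := fun j => by
        simp [Finset.mul_sum, mul_assoc]
      simp only [e2, norm_mul, mul_pow, ← Finset.mul_sum]
      rw [Prod.smul_snd, e, qform_smul, Complex.re_ofReal_mul]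
      simpa [Real.sq_sqrt hc] using mul_le_mul_of_nonneg_left (hB ξ) hc

theorem mem_dominationCone (h : IsNumRadSpace W) {n : ℕ}
    {q : Matrix (Fin n) (Fin n) X × Matrix (Fin n) (Fin n) ℂ} :
    q ∈ dominationCone h n ↔
      ∃ (m : ℕ) (α : Matrix (Fin n) (Fin m) ℂ) (x : Matrix (Fin m) (Fin m) X),
        W m x ≤ 1 ∧ conj α x = q.1 ∧
          ∀ ξ, ∑ j, ‖∑ i, star (α i j) * ξ i‖ ^ 2 ≤ (qform q.2 ξ).re :=
  Iff.rfl

theorem exists_add_mem_dominationCone (h : IsNumRadSpace W) {n : ℕ}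
    (q : Matrix (Fin n) (Fin n) X × Matrix (Fin n) (Fin n) ℂ) :
    ∃ s : ℝ, (0, (s : ℂ) • 1) + q ∈ dominationCone h n := by
  obtain ⟨y, B⟩ := q
  have hw : 0 < W n y + 1 := by have := h.nonneg n y; linarith
  have hs : ((Real.sqrt (W n y + 1) : ℝ) : ℂ) * star ((Real.sqrt (W n y + 1) : ℝ) : ℂ)
      = ((W n y + 1 : ℝ) : ℂ) := by
    rw [Complex.star_def, Complex.conj_ofReal, ← Complex.ofReal_mul, Real.mul_self_sqrt hw.le]
  -- Here `α` is the scalar `√(W y + 1)` and `x = y / (W y + 1)`; the `1` avoids dividing by zero,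
  -- and `numRadius n B` absorbs the possibly negative real part of `B`.
  refine ⟨W n y + 1 + numRadius n B, (mem_dominationCone h).2 ⟨n,
    ((Real.sqrt (W n y + 1) : ℝ) : ℂ) • 1, (((W n y + 1)⁻¹ : ℝ) : ℂ) • y, ?_, ?_, fun ξ => ?_⟩⟩
  · rw [h.smul_eq, Complex.norm_real, Real.norm_eq_abs, abs_of_pos (inv_pos.2 hw),
      inv_mul_le_iff₀ hw]
    linarith
  · rw [conj_smul, hs]
    have : conj (1 : Matrix (Fin n) (Fin n) ℂ) ((((W n y + 1)⁻¹ : ℝ) : ℂ) • y) =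
        (((W n y + 1)⁻¹ : ℝ) : ℂ) • y := by
      ext i j; simp [conj, Matrix.one_apply, apply_ite, ite_smul]
    rw [this, smul_smul, ← Complex.ofReal_mul, mul_inv_cancel₀ hw.ne']
    simp
  · have e2 : ∀ j, ∑ i, star ((((Real.sqrt (W n y + 1) : ℝ) : ℂ) • (1 : Matrix _ _ ℂ)) i j) * ξ i =
        ((Real.sqrt (W n y + 1) : ℝ) : ℂ) * ξ j := fun j => by
      simp [Matrix.one_apply, apply_ite]
    simp only [e2, norm_mul, mul_pow, ← Finset.mul_sum]
    rw [Prod.snd_add, qform_add, qform_smul, qform_one, ← Complex.ofReal_mul, Complex.add_re,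
      Complex.ofReal_re, Complex.norm_real, Real.norm_eq_abs, sq_abs, Real.sq_sqrt hw.le]
    have h1 := norm_qform_le B ξ
    have h2 := neg_le_of_abs_le ((Complex.abs_re_le_norm (qform B ξ)).trans h1)
    linarith

/-- On the span of `(x₀, 0)` and `(0, 1)` the functional `(t x₀, s 1) ↦ s - t W x₀` is nonnegative
on the cone, by WII. Riesz extension makes it a functional `g` nonnegative on the whole cone, and
`F`, `p` are `-g` and `g` on the two summands. -/
theorem exists_dominated_functional (h : IsNumRadSpace W) {n : ℕ}
    {x₀ : Matrix (Fin n) (Fin n) X} (hx₀ : x₀ ≠ 0) :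
    ∃ (F : Matrix (Fin n) (Fin n) X →ₗ[ℝ] ℝ) (p : Matrix (Fin n) (Fin n) ℂ →ₗ[ℝ] ℝ),
      F x₀ = W n x₀ ∧ p 1 = 1 ∧ (∀ B, (∀ ξ, 0 ≤ (qform B ξ).re) → 0 ≤ p B) ∧
      ∀ (m : ℕ) (α : Matrix (Fin n) (Fin m) ℂ) (x : Matrix (Fin m) (Fin m) X), W m x ≤ 1 →
        F (conj α x) ≤ p (α * αᴴ) := by
  -- Needed for `1 ≠ 0` in the matrix algebra and for a `SqBound` constant to be nonnegative.
  have hn : Nonempty (Fin n) := by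
    by_contra hne
    rw [not_nonempty_iff] at hne
    exact hx₀ (Subsingleton.elim _ _)
  let T : ℝ × ℝ →ₗ[ℝ] Matrix (Fin n) (Fin n) X × Matrix (Fin n) (Fin n) ℂ :=
    LinearMap.prodMap (LinearMap.toSpanSingleton ℝ _ x₀) (LinearMap.toSpanSingleton ℝ _ 1)
  have hT : Function.Injective T := by
    exact Prod.map_injective.2 ⟨smul_left_injective ℝ hx₀, smul_left_injective ℝ
      (one_ne_zero : (1 : Matrix (Fin n) (Fin n) ℂ) ≠ 0)⟩
  let f : (Matrix (Fin n) (Fin n) X × Matrix (Fin n) (Fin n) ℂ) →ₗ.[ℝ] ℝ :=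
    { domain := LinearMap.range T
      toFun := (LinearMap.snd ℝ ℝ ℝ - W n x₀ • LinearMap.fst ℝ ℝ ℝ) ∘ₗ
        (LinearEquiv.ofInjective T hT).symm.toLinearMap }
  have hf : ∀ t s : ℝ, ∀ hq : T (t, s) ∈ f.domain, f ⟨T (t, s), hq⟩ = s - W n x₀ * t := by
    intro t s hq
    have : (LinearEquiv.ofInjective T hT).symm ⟨T (t, s), hq⟩ = (t, s) := by
      rw [LinearEquiv.symm_apply_eq]; rfl
    change (LinearMap.snd ℝ ℝ ℝ - W n x₀ • LinearMap.fst ℝ ℝ ℝ)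
      ((LinearEquiv.ofInjective T hT).symm ⟨T (t, s), hq⟩) = _
    rw [this]
    simp
  have hTe : ∀ t s : ℝ, T (t, s) = ((t : ℂ) • x₀, (s : ℂ) • 1) := by
    intro t s
    refine Prod.ext ?_ ?_
    · ext i j; exact (Complex.coe_smul t _).symm
    · ext i j; exact (Complex.coe_smul s _).symm
  have h_nonneg : ∀ q : f.domain, (q : _ × _) ∈ dominationCone h n → 0 ≤ f q := by
    rintro ⟨_, ⟨t, s⟩, rfl⟩ hq
    refine le_of_le_of_eq ?_ (hf t s ⟨_, rfl⟩).symm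
    obtain ⟨m, α, x, hx, hc, hα⟩ := (mem_dominationCone h).1 hq
    simp only [hTe] at hc hα
    have hs : SqBound α s := fun ξ => by
      have := hα ξ
      rwa [qform_smul, qform_one, ← Complex.ofReal_mul, Complex.ofReal_re] at this
    have h1 := h.conj_le_of_sqBound hs.nonneg hs x
    have h2 : W n (conj α x) = |t| * W n x₀ := by
      rw [hc, h.smul_eq, Complex.norm_real, Real.norm_eq_abs]
    have h3 : |t| * W n x₀ ≤ s := by
      rw [← h2]; exact h1.trans (mul_le_of_le_one_right hs.nonneg hx)
    have h4 := mul_le_mul_of_nonneg_right (le_abs_self t) (h.nonneg n x₀)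
    linarith
  have h_dense : ∀ q, ∃ r : f.domain, (r : _ × _) + q ∈ dominationCone h n := by
    intro q
    obtain ⟨s, hs⟩ := exists_add_mem_dominationCone h q
    refine ⟨⟨T (0, s), ⟨_, rfl⟩⟩, ?_⟩
    simpa [hTe] using hs
  obtain ⟨g, hg, hg0⟩ := riesz_extension (dominationCone h n) f h_nonneg h_dense
  have hgT : ∀ t s : ℝ, g ((t : ℂ) • x₀, (s : ℂ) • 1) = s - W n x₀ * t := fun t s => by
    rw [← hTe, ← hf t s ⟨_, rfl⟩, ← hg]
  refine ⟨-(g ∘ₗ LinearMap.inl ℝ _ _), g ∘ₗ LinearMap.inr ℝ _ _, ?_, ?_, ?_, ?_⟩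
  · have := hgT 1 0
    simp only [Complex.ofReal_one, Complex.ofReal_zero, one_smul, zero_smul] at this
    simp [this]
  · have := hgT 0 1
    simp only [Complex.ofReal_one, Complex.ofReal_zero, one_smul, zero_smul] at this
    simp [this]
  · intro B hB
    -- With an empty `α` the cone contains `(0, B)` for every `B` with positive real part.
    refine hg0 _ ((mem_dominationCone h).2 ⟨0, 0, 0, ?_, ?_, fun ξ => ?_⟩)
    · rw [h.map_zero]; exact zero_le_one
    · ext; simp [conj]
    · simpa using hB ξ
  · intro m α x hx
    have := hg0 (conj α x, α * αᴴ) ((mem_dominationCone h).2 ⟨m, α, x, hx, rfl, fun ξ => ?_⟩)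
    · have e : (conj α x, α * αᴴ) = (conj α x, (0 : Matrix (Fin n) (Fin n) ℂ)) +
          ((0 : Matrix (Fin n) (Fin n) X), α * αᴴ) := by simp
      rw [e, map_add] at this
      simp only [LinearMap.neg_apply, LinearMap.comp_apply, LinearMap.inl_apply,
        LinearMap.inr_apply]
      linarith
    · rw [qform_mul_conjTranspose, Complex.ofReal_re]

end Domination

/-! ### From functionals on matrices to completely contractive maps. -/

section Pairing

open scoped ComplexOrder

variable {X : Type*} [AddCommGroup X] [Module ℂ X] {W : MatrixNorms X}

/-- The scalar pairing of a matrix of functionals with a matrix of vectors. -/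
def pairing {n : ℕ} (f : Matrix (Fin n) (Fin n) (X →ₗ[ℂ] ℂ)) (y : Matrix (Fin n) (Fin n) X) : ℂ :=
  ∑ i, ∑ j, f i j (y i j)

theorem conj_conj {k m n : ℕ} (α : Matrix (Fin k) (Fin m) ℂ) (β : Matrix (Fin m) (Fin n) ℂ)
    (x : Matrix (Fin n) (Fin n) X) : conj α (conj β x) = conj (α * β) x := by
  ext i j
  simp only [conj, Matrix.of_apply, Matrix.mul_apply, Finset.smul_sum, smul_smul, star_sum,
    Finset.sum_mul_sum, Finset.sum_smul]
  simp_rw [Finset.sum_comm (s := Finset.univ (α := Fin m)) (t := Finset.univ (α := Fin n))]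
  refine Finset.sum_congr rfl fun a _ => Finset.sum_congr rfl fun b _ =>
    Finset.sum_congr rfl fun c _ => Finset.sum_congr rfl fun d _ => ?_
  congr 1
  simp
  ring

theorem conj_one {n : ℕ} (x : Matrix (Fin n) (Fin n) X) : conj 1 x = x := by
  ext i j
  simp [conj, Matrix.one_apply, apply_ite, ite_smul]

theorem conj_smul_right {m n : ℕ} (c : ℂ) (α : Matrix (Fin n) (Fin m) ℂ)
    (x : Matrix (Fin m) (Fin m) X) : conj α (c • x) = c • conj α x := by
  ext i j
  simp only [conj, Matrix.of_apply, Matrix.smul_apply, Finset.smul_sum]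
  refine Finset.sum_congr rfl fun _ _ => Finset.sum_congr rfl fun _ _ => smul_comm _ _ _

/-- Conjugation moves across the pairing; the pairing is bilinear in the two matrices, hence a
transpose rather than an adjoint. -/
theorem pairing_conj {m n : ℕ} (C : Matrix (Fin n) (Fin m) ℂ)
    (f : Matrix (Fin n) (Fin n) (X →ₗ[ℂ] ℂ)) (y : Matrix (Fin m) (Fin m) X) :
    pairing (conj Cᵀ f) y = pairing f (conj C y) := by
  simp only [pairing, conj, Matrix.of_apply, Matrix.transpose_apply, LinearMap.sum_apply,
    LinearMap.smul_apply, map_sum, map_smul]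
  simp_rw [Finset.sum_comm (s := Finset.univ (α := Fin m)) (t := Finset.univ (α := Fin n))]

/-- Reading a vector `ξ` as an `n × k` matrix `α` turns numerical radius estimates for `[φ_ij x_ab]`
into estimates of one scalar functional on the elements `α x α*`. -/
theorem qform_amp {k n : ℕ} (φ : Matrix (Fin n) (Fin n) (X →ₗ[ℂ] ℂ))
    (x : Matrix (Fin k) (Fin k) X) (ξ : Fin k × Fin n → ℂ) :
    qform (amp φ x) ξ = pairing φ (conj (Matrix.of fun i a => star (ξ (a, i))) x) := by
  simp only [qform, amp, pairing, conj, Matrix.of_apply, map_sum, map_smul, Fintype.sum_prod_type,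
    star_star, smul_eq_mul]
  rw [Finset.sum_comm]
  refine Finset.sum_congr rfl fun i _ => ?_
  rw [Finset.sum_comm (s := Finset.univ (α := Fin n)) (t := Finset.univ (α := Fin k))]
  refine Finset.sum_congr rfl fun a _ => ?_
  rw [Finset.sum_comm]
  refine Finset.sum_congr rfl fun b _ => Finset.sum_congr rfl fun j _ => ?_
  ring

theorem qform_conjTranspose {ι : Type*} [Fintype ι] (B : Matrix ι ι ℂ) (ξ : ι → ℂ) :
    qform Bᴴ ξ = star (qform B ξ) := by
  simp only [qform, star_sum, Matrix.conjTranspose_apply]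
  rw [Finset.sum_comm]
  refine Finset.sum_congr rfl fun _ _ => Finset.sum_congr rfl fun _ _ => ?_
  simp
  ring

/-- A real functional that is nonnegative on matrices with positive real part is the real part of
`B ↦ tr (R B)` with `R` positive semidefinite. -/
theorem exists_posSemidef_trace {n : ℕ} (p : Matrix (Fin n) (Fin n) ℂ →ₗ[ℝ] ℝ)
    (hp : ∀ B, (∀ ξ, 0 ≤ (qform B ξ).re) → 0 ≤ p B) :
    ∃ R : Matrix (Fin n) (Fin n) ℂ, R.PosSemidef ∧ ∀ B, (R * B).trace.re = p B := by
  let P : Matrix (Fin n) (Fin n) ℂ →ₗ[ℂ] ℂ := Module.Dual.extendRCLike p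
  have hre : ∀ B, (P B).re = p B := fun B => Module.Dual.re_extendRCLike_apply (𝕜 := ℂ) p B
  have him : ∀ B, (P B).im = -p (Complex.I • B) := fun B =>
    Module.Dual.im_extendRCLike_apply (𝕜 := ℂ) p B
  -- Both `B` and `-B` have nonnegative real part. Applied to `Bᴴ - B` and `i (Bᴴ + B)`, this shows
  -- that the complexified functional is Hermitian.
  have hskew : ∀ B, (∀ ξ, (qform B ξ).re = 0) → p B = 0 := fun B hB => by
    refine le_antisymm ?_ (hp B fun ξ => (hB ξ).ge)
    have := hp ((-1 : ℂ) • B) fun ξ => by rw [qform_smul]; simp [hB]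
    simpa using this
  have hstar : ∀ B, P Bᴴ = star (P B) := fun B => by
    have h1 := hskew (Bᴴ + (-1 : ℂ) • B) fun ξ => by
      rw [qform_add, qform_smul, qform_conjTranspose]; simp
    have h2 := hskew (Complex.I • Bᴴ + Complex.I • B) fun ξ => by
      rw [qform_add, qform_smul, qform_smul, qform_conjTranspose]; simp
    rw [neg_one_smul, map_add, _root_.map_neg] at h1
    rw [map_add] at h2
    refine Complex.ext ?_ ?_
    · rw [Complex.star_def, Complex.conj_re, hre, hre]; linarith
    · rw [Complex.star_def, Complex.conj_im, him, him]; linarith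
  let R : Matrix (Fin n) (Fin n) ℂ := Matrix.of fun j i => P (Matrix.single i j 1)
  have htr : ∀ B, (R * B).trace = P B := fun B => by
    conv_rhs => rw [Matrix.matrix_eq_sum_single B]
    simp only [Matrix.trace, Matrix.diag, Matrix.mul_apply, map_sum]
    rw [Finset.sum_comm]
    refine Finset.sum_congr rfl fun i _ => Finset.sum_congr rfl fun j _ => ?_
    have : Matrix.single i j (B i j) = B i j • Matrix.single i j (1 : ℂ) := by
      rw [Matrix.smul_single, smul_eq_mul, mul_one]
    rw [this, map_smul, smul_eq_mul, mul_comm]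
    rfl
  refine ⟨R, .of_dotProduct_mulVec_nonneg ?_ fun v => ?_, fun B => by rw [htr, hre]⟩
  · ext i j
    change star (P (Matrix.single i j 1)) = P (Matrix.single j i 1)
    rw [← hstar, Matrix.conjTranspose_single, star_one]
  · have e : star v ⬝ᵥ R *ᵥ v = P (Matrix.vecMulVec v (star v)) := by
      rw [← htr, Matrix.mul_vecMulVec, Matrix.trace_vecMulVec, dotProduct_comm]
    have hB : (Matrix.vecMulVec v (star v))ᴴ = Matrix.vecMulVec v (star v) := by
      rw [Matrix.conjTranspose_vecMulVec, star_star]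
    have hc := hstar (Matrix.vecMulVec v (star v))
    rw [hB] at hc
    rw [e, Complex.nonneg_iff]
    refine ⟨?_, (Complex.conj_eq_iff_im.1 hc.symm).symm⟩
    rw [hre]
    refine hp _ fun ξ => ?_
    have : Matrix.vecMulVec v (star v) = Matrix.replicateCol (Fin 1) v *
        (Matrix.replicateCol (Fin 1) v)ᴴ := by
      ext i j
      simp [Matrix.vecMulVec_apply, Matrix.mul_apply]
    rw [this, qform_mul_conjTranspose, Complex.ofReal_re]
    positivity

/-- The complex form of `exists_dominated_functional`: `F` is the real part of a complex functional,
whose restrictions to the matrix units are the entries of `f`, and `p` is given by the density `R`.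
-/
theorem exists_pairing_dominated (h : IsNumRadSpace W) {n : ℕ}
    {x₀ : Matrix (Fin n) (Fin n) X} (hx₀ : x₀ ≠ 0) :
    ∃ (f : Matrix (Fin n) (Fin n) (X →ₗ[ℂ] ℂ)) (R : Matrix (Fin n) (Fin n) ℂ), R.PosSemidef ∧
      R.trace.re = 1 ∧ W n x₀ ≤ ‖pairing f x₀‖ ∧
      ∀ (m : ℕ) (α : Matrix (Fin n) (Fin m) ℂ) (x : Matrix (Fin m) (Fin m) X),
        ‖pairing f (conj α x)‖ ≤ (R * (α * αᴴ)).trace.re * W m x := by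
  obtain ⟨F, p, hF, hp1, hp, hle⟩ := exists_dominated_functional h hx₀
  obtain ⟨R, hR, hRp⟩ := exists_posSemidef_trace p hp
  let G : Matrix (Fin n) (Fin n) X →ₗ[ℂ] ℂ := Module.Dual.extendRCLike F
  have hre : ∀ y, (G y).re = F y := fun y => Module.Dual.re_extendRCLike_apply (𝕜 := ℂ) F y
  have hsq : ∀ y, ‖G y‖ ^ 2 = F ((starRingEnd ℂ) (G y) • y) := fun y =>
    Module.Dual.norm_extendRCLike_apply_sq (𝕜 := ℂ) F y
  have hpair : ∀ y, pairing (Matrix.of fun i j => G ∘ₗ Matrix.singleLinearMap ℂ i j) y = G y :=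
    fun y => by
      conv_rhs => rw [Matrix.matrix_eq_sum_single y]
      simp [pairing]
  have hcoe : ∀ (c : ℝ) (y : Matrix (Fin n) (Fin n) X), F ((c : ℂ) • y) = c * F y := fun c y => by
    have : (c : ℂ) • y = c • y := by ext i j; exact Complex.coe_smul c _
    rw [this, map_smul, smul_eq_mul]
  have hF' : ∀ (m : ℕ) (α : Matrix (Fin n) (Fin m) ℂ) (x : Matrix (Fin m) (Fin m) X),
      F (conj α x) ≤ p (α * αᴴ) * W m x := fun m α x => by
    by_cases h0 : W m x = 0
    · have e : conj α x = 0 := by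
        rw [h.eq_zero m x h0]; ext; simp [conj]
      rw [e, h0, mul_zero, _root_.map_zero]
    · have hn : ‖(((W m x)⁻¹ : ℝ) : ℂ)‖ = (W m x)⁻¹ := by
        simp [abs_of_nonneg (h.nonneg m x)]
      have := hle m α ((((W m x)⁻¹ : ℝ) : ℂ) • x) (by
        rw [h.smul_eq, hn, inv_mul_cancel₀ h0])
      rw [conj_smul_right, hcoe,
        inv_mul_le_iff₀ (lt_of_le_of_ne (h.nonneg m x) (Ne.symm h0))] at this
      linarith
  refine ⟨Matrix.of fun i j => G ∘ₗ Matrix.singleLinearMap ℂ i j, R, hR, ?_, ?_,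
    fun m α x => ?_⟩
  · rw [← mul_one R, hRp, hp1]
  · have := Complex.re_le_norm (G x₀)
    rw [hre, hF] at this
    exact this.trans_eq (congrArg _ (hpair x₀).symm)
  · refine (congrArg _ (hpair (conj α x))).trans_le ?_
    rw [hRp]
    by_cases h0 : ‖G (conj α x)‖ = 0
    · rw [h0]
      refine mul_nonneg (hp _ fun ξ => ?_) (h.nonneg _ _)
      rw [qform_mul_conjTranspose, Complex.ofReal_re]
      positivity
    -- Multiplying `x` by the conjugate of `G (conj α x)` makes the value real, so the bound for `F`
    -- gives `|G|² ≤ p (α α*) |G| W x`, and one factor cancels.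
    · have h1 := hsq (conj α x)
      rw [← conj_smul_right] at h1
      have h2 := hF' m α ((starRingEnd ℂ) (G (conj α x)) • x)
      rw [← h1, h.smul_eq, RCLike.norm_conj] at h2
      refine le_of_mul_le_mul_right ?_ (lt_of_le_of_ne (norm_nonneg _) (Ne.symm h0))
      nlinarith

theorem trace_conjTranspose_mul_self_re {m n : ℕ} (η : Matrix (Fin n) (Fin m) ℂ) :
    (ηᴴ * η).trace.re = ∑ a, ∑ i, ‖η i a‖ ^ 2 := by
  simp [Matrix.trace, Matrix.mul_apply, Complex.conj_mul', ← Complex.ofReal_pow]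

/-- The map is `f` conjugated by `C = B⁻¹`, where `B* B` is a perturbation of `R`. At `ξ`, read as
`α`, its quadratic form is `f(Cα x α*C*)`, bounded by `tr(R Cα α*C*) W x ≤ ‖BCα‖² W x = ‖ξ‖² W x` in
the Hilbert-Schmidt norm. -/
theorem exists_contractive_amp (h : IsNumRadSpace W) {n : ℕ} (x₀ : Matrix (Fin n) (Fin n) X)
    {ε : ℝ} (hε : 0 < ε) :
    ∃ φ : Matrix (Fin n) (Fin n) (X →ₗ[ℂ] ℂ),
      (∀ (k : ℕ) (x : Matrix (Fin k) (Fin k) X), finNorm numRadius (amp φ x) ≤ W k x) ∧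
      W n x₀ ≤ (1 + ε) * finNorm numRadius (amp φ x₀) := by
  by_cases hx₀ : x₀ = 0
  · have e : ∀ (k : ℕ) (x : Matrix (Fin k) (Fin k) X),
        amp (0 : Matrix (Fin n) (Fin n) (X →ₗ[ℂ] ℂ)) x = 0 := fun k x => by ext; simp [amp]
    refine ⟨0, fun k x => ?_, ?_⟩
    · rw [e, isNumRadSpace_complex.finNorm_zero]; exact h.nonneg k x
    · rw [e, isNumRadSpace_complex.finNorm_zero, hx₀, h.map_zero, mul_zero]
  obtain ⟨f, R, hR, hR1, hf₀, hf⟩ := exists_pairing_dominated h hx₀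
  -- `R` may be singular, so `ε / (n + 1)` is added on the diagonal; this raises the trace by at
  -- most `ε`, and the denominator is positive for every `n`.
  obtain ⟨B, C, hB, hBC, hCB⟩ : ∃ B C : Matrix (Fin n) (Fin n) ℂ,
      R + ((ε / (n + 1) : ℝ) : ℂ) • 1 = Bᴴ * B ∧ B * C = 1 ∧ C * B = 1 := by
    have hδ : 0 < ε / (n + 1) := by positivity
    have hpd : (R + ((ε / (n + 1) : ℝ) : ℂ) • (1 : Matrix (Fin n) (Fin n) ℂ)).PosDef :=
      Matrix.PosDef.posSemidef_add hR (Matrix.PosDef.one.smul (by exact_mod_cast hδ))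
    open scoped MatrixOrder Matrix.Norms.L2Operator in
    obtain ⟨B, hB⟩ := CStarAlgebra.nonneg_iff_eq_star_mul_self.1 hpd.posSemidef.nonneg
    have hu := hpd.isUnit
    rw [hB] at hu
    have hBu : IsUnit B := by
      rw [Matrix.isUnit_iff_isUnit_det] at hu ⊢
      rw [Matrix.det_mul] at hu
      exact isUnit_of_mul_isUnit_right hu
    obtain ⟨u, rfl⟩ := hBu
    exact ⟨u, ↑u⁻¹, hB, u.mul_inv, u.inv_mul⟩
  have hdom : ∀ {m : ℕ} (α : Matrix (Fin n) (Fin m) ℂ),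
      (R * (α * αᴴ)).trace.re ≤ ∑ a, ∑ i, ‖(B * α) i a‖ ^ 2 := fun α => by
    rw [← trace_conjTranspose_mul_self_re]
    have e : ((B * α)ᴴ * (B * α)).trace =
        (R * (α * αᴴ)).trace + ((ε / (n + 1) : ℝ) : ℂ) * (αᴴ * α).trace := by
      rw [Matrix.conjTranspose_mul, Matrix.mul_assoc, ← Matrix.mul_assoc Bᴴ, ← hB,
        Matrix.add_mul, Matrix.mul_add, Matrix.trace_add, Matrix.trace_mul_comm, Matrix.mul_assoc]
      simp
    rw [e, Complex.add_re, Complex.re_ofReal_mul, trace_conjTranspose_mul_self_re]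
    have : 0 ≤ ε / (n + 1) * ∑ a, ∑ i, ‖α i a‖ ^ 2 := by positivity
    linarith
  have hq : ∀ {k : ℕ} (x : Matrix (Fin k) (Fin k) X) (ξ : Fin k × Fin n → ℂ),
      qform (amp (conj Cᵀ f) x) ξ =
        pairing f (conj (C * Matrix.of fun i a => star (ξ (a, i))) x) := fun x ξ => by
    rw [qform_amp, pairing_conj, conj_conj]
  refine ⟨conj Cᵀ f, fun k x => ?_, ?_⟩
  · rw [finNorm_numRadius_le_iff _ (h.nonneg k x)]
    intro ξ
    rw [hq, mul_comm]
    refine (hf _ _ _).trans (mul_le_mul_of_nonneg_right ((hdom _).trans_eq ?_) (h.nonneg _ _))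
    rw [← Matrix.mul_assoc, hBC, Matrix.one_mul, Fintype.sum_prod_type]
    simp
  -- This vector corresponds to `α = B`, so `C α = 1` and the form equals `f(x₀)`; its squared norm
  -- is the trace of `B* B`.
  · have h1 := norm_qform_le_finNorm (amp (conj Cᵀ f) x₀) fun q => star (B q.2 q.1)
    have e : (Matrix.of fun i a => star (star (B i a))) = B := by ext; simp
    rw [hq, e, hCB, conj_one] at h1
    have h2 : ∑ q : Fin n × Fin n, ‖star (B q.2 q.1)‖ ^ 2 = 1 + ε / (n + 1) * n := by
      rw [Fintype.sum_prod_type]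
      simp only [norm_star]
      rw [← trace_conjTranspose_mul_self_re, ← hB, Matrix.trace_add, Matrix.trace_smul,
        Matrix.trace_one, Complex.add_re, hR1, smul_eq_mul, Complex.re_ofReal_mul]
      simp
    rw [h2, mul_comm] at h1
    refine hf₀.trans (h1.trans (mul_le_mul_of_nonneg_right ?_
      (isNumRadSpace_complex.finNorm_nonneg _)))
    have : ε / (n + 1) * n ≤ ε := by
      rw [div_mul_eq_mul_div, div_le_iff₀ (by positivity)]
      nlinarith
    linarith

end Pairing

/-! ### The dual and the bidual embedding. -/

section Duality

variable {X : Type*} [AddCommGroup X] [Module ℂ X] {W : MatrixNorms X}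

theorem norm_le_numRadius_one (z : ℂ) : ‖z‖ ≤ numRadius 1 (Matrix.of fun _ _ => z) := by
  simpa [qform] using norm_qform_le (Matrix.of fun (_ _ : Fin 1) => z) fun _ => 1

/-- The dual consists of the functionals that are bounded for `W 1`. -/
theorem mem_Dual_iff (h : IsNumRadSpace W) (f : X →ₗ[ℂ] ℂ) :
    f ∈ Dual W ↔ ∃ C : ℝ, ∀ x : X, ‖f x‖ ≤ C * W 1 (Matrix.of fun _ _ => x) := by
  refine (cbNorm_lt_top_iff h isNumRadSpace_complex.smul_eq f).trans ⟨?_, ?_⟩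
  · rintro ⟨c, -, hc⟩
    exact ⟨c, fun x => (norm_le_numRadius_one _).trans (hc 1 (Matrix.of fun _ _ => x))⟩
  · rintro ⟨C, hC⟩
    refine ⟨|C|, abs_nonneg C, fun n x => ?_⟩
    rw [numRadius_le_iff _ (mul_nonneg (abs_nonneg C) (h.nonneg n x))]
    intro ξ
    -- Boundedness at level one suffices: the quadratic form of `f_n x` at `ξ` is `f` of the `1 × 1`
    -- compression `ξ* x ξ`, whose norm is at most `‖ξ‖² W x` by WII.
    have h1 := h.conj_le_of_sqBound (Finset.sum_nonneg fun _ _ => sq_nonneg _)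
      (sqBound_row fun i => star (ξ i)) x
    have h2 := (hC (∑ i, ∑ j, (star (ξ i) * ξ j) • x i j)).trans
      (mul_le_mul_of_nonneg_right (le_abs_self C) (h.nonneg _ _))
    have e1 : qform (x.map f) ξ = f (∑ i, ∑ j, (star (ξ i) * ξ j) • x i j) := by
      simp only [qform, map_sum, map_smul, Matrix.map_apply, smul_eq_mul]
      refine Finset.sum_congr rfl fun _ _ => Finset.sum_congr rfl fun _ _ => by ring
    have e2 : sandwich (Matrix.of fun (_ : Fin 1) i => star (ξ i)) x
        (Matrix.of fun (_ : Fin 1) i => star (ξ i)) =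
        Matrix.of fun _ _ => ∑ i, ∑ j, (star (ξ i) * ξ j) • x i j := by
      ext; simp [sandwich]
    rw [e2] at h1
    simp only [norm_star] at h1
    rw [e1]
    refine h2.trans ((mul_le_mul_of_nonneg_left h1 (abs_nonneg C)).trans_eq (by ring))

/-- The canonical map into the bidual. -/
def bidualMap (h : IsNumRadSpace W) : X →ₗ[ℂ] Dual (dualNorms W) where
  toFun x := ⟨(LinearMap.applyₗ x).comp (Dual W).subtype,
    (mem_Dual_iff (isNumRadSpace_wcbNorms h isNumRadSpace_complex) _).2
      ⟨W 1 (Matrix.of fun _ _ => x), fun f => by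
        have h1 := finNorm_amp_le h isNumRadSpace_complex
          (Matrix.of fun (_ _ : Fin 1) => f) (Matrix.of fun (_ _ : Fin 1) => x)
        have h2 := norm_qform_le_finNorm (amp (unbundle (Matrix.of fun (_ _ : Fin 1) => f))
          (Matrix.of fun (_ _ : Fin 1) => x)) fun _ => 1
        refine le_of_eq_of_le ?_ ((h2.trans_eq (by simp)).trans (h1.trans_eq (mul_comm _ _)))
        simp [qform, amp]⟩⟩
  map_add' x y := by ext; simp
  map_smul' c x := by ext; simp

theorem bidualMap_apply (h : IsNumRadSpace W) (x : X) (f : Dual W) :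
    (bidualMap h x : Dual W →ₗ[ℂ] ℂ) f = (f : X →ₗ[ℂ] ℂ) x := rfl

theorem amp_bidualMap (h : IsNumRadSpace W) {n k : ℕ} (x : Matrix (Fin n) (Fin n) X)
    (f : Matrix (Fin k) (Fin k) (Dual W)) :
    amp (unbundle (x.map (bidualMap h))) f =
      (amp (unbundle f) x).submatrix (Equiv.prodComm _ _) (Equiv.prodComm _ _) := rfl

/-- Evaluating `x` on `f` and `f` on `x` gives the same scalar matrix up to swapping the index
pairs. So the norm bound for `f` gives contractivity, and testing on the contractions of
`exists_contractive_amp` gives the reverse inequality as `ε → 0`. -/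
theorem isCompleteIsometry_bidualMap (h : IsNumRadSpace W) :
    IsCompleteIsometry W (dualNorms (dualNorms W)) (bidualMap h) := by
  have hD : IsNumRadSpace (dualNorms W) := isNumRadSpace_wcbNorms h isNumRadSpace_complex
  intro n x
  refine le_antisymm ?_ ?_
  · refine (wcbNorms_le_iff hD isNumRadSpace_complex _ (h.nonneg n x)).2 fun k f => ?_
    rw [amp_bidualMap, isNumRadSpace_complex.finNorm_submatrix, mul_comm]
    exact finNorm_amp_le h isNumRadSpace_complex f x
  · have hε : ∀ ε : ℝ, 0 < ε → W n x ≤ (1 + ε) * dualNorms (dualNorms W) n (x.map (bidualMap h)) :=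
      fun ε hε => by
        obtain ⟨φ, hφ, hx⟩ := exists_contractive_amp h x hε
        have hmem : ∀ i j, φ i j ∈ Dual W :=
          (forall_mem_WCB_iff h isNumRadSpace_complex n φ).2
            ((cbNorm_lt_top_iff h (matNorms_smul isNumRadSpace_complex n) _).2
              ⟨1, zero_le_one, fun k y => by
                rw [matNorms_map isNumRadSpace_complex, one_mul]; exact hφ k y⟩)
        let f : Matrix (Fin n) (Fin n) (Dual W) := Matrix.of fun i j => ⟨φ i j, hmem i j⟩
        have hf : dualNorms W n f ≤ 1 :=
          (wcbNorms_le_iff h isNumRadSpace_complex f zero_le_one).2 fun k y => by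
            rw [one_mul]; exact hφ k y
        have h1 := finNorm_amp_le hD isNumRadSpace_complex (x.map (bidualMap h)) f
        rw [amp_bidualMap, isNumRadSpace_complex.finNorm_submatrix] at h1
        refine hx.trans (mul_le_mul_of_nonneg_left ?_ (by positivity))
        exact h1.trans (mul_le_of_le_one_right (wcbNorms_nonneg _) hf)
    have hlim : Filter.Tendsto
        (fun ε : ℝ => (1 + ε) * dualNorms (dualNorms W) n (x.map (bidualMap h)))
        (nhdsWithin 0 (Set.Ioi 0)) (nhds (dualNorms (dualNorms W) n (x.map (bidualMap h)))) := by
      have : Continuous fun ε : ℝ =>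
        (1 + ε) * dualNorms (dualNorms W) n (x.map (bidualMap h)) := by fun_prop
      have h0 := (this.tendsto 0).mono_left (nhdsWithin_le_nhds (s := Set.Ioi 0))
      simpa using h0
    exact ge_of_tendsto hlim (Filter.eventually_of_mem self_mem_nhdsWithin hε)

end Duality

end NumRad

end

theorem proposition2p7 {X : Type*} [AddCommGroup X] [Module ℂ X]
    {Y : Type*} [AddCommGroup Y] [Module ℂ Y]
    (WX : NumRad.MatrixNorms X) (WY : NumRad.MatrixNorms Y)
    (hX : NumRad.IsNumRadSpace WX) (hY : NumRad.IsNumRadSpace WY) :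
    -- (1) a matrix of linear maps has W-completely bounded entries exactly when the induced map
    -- into M_n(Y) is W-completely bounded; WCB(X, Y) is a numerical radius operator space
    ((∀ (n : ℕ) (φ : Matrix (Fin n) (Fin n) (X →ₗ[ℂ] Y)),
        (∀ i j, φ i j ∈ NumRad.WCB WX WY hY) ↔
          NumRad.cbNorm WX (NumRad.matNorms WY n) (NumRad.toMatrixMap φ) < ⊤) ∧
      NumRad.IsNumRadSpace (NumRad.wcbNorms WX WY hY)) ∧
    -- (2) the dual consists of the bounded functionals, and the canonical map into the bidual is
    -- W-completely isometric
    ((∀ f : X →ₗ[ℂ] ℂ, f ∈ NumRad.Dual WX ↔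
        ∃ C : ℝ, ∀ x : X, ‖f x‖ ≤ C * WX 1 (Matrix.of fun _ _ => x)) ∧
      ∃ ι : X →ₗ[ℂ] NumRad.Dual (NumRad.dualNorms WX),
        (∀ (x : X) (f : NumRad.Dual WX),
          (ι x : NumRad.Dual WX →ₗ[ℂ] ℂ) f = (f : X →ₗ[ℂ] ℂ) x) ∧
        NumRad.IsCompleteIsometry WX (NumRad.dualNorms (NumRad.dualNorms WX)) ι) ∧
    -- (3) quotients by closed subspaces
    (∀ N : Submodule ℂ X, NumRad.IsClosedSubspace WX N →
      NumRad.IsNumRadSpace (NumRad.quotNorms WX N)) := by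
  exact ⟨⟨NumRad.forall_mem_WCB_iff hX hY, NumRad.isNumRadSpace_wcbNorms hX hY⟩,
    ⟨NumRad.mem_Dual_iff hX, NumRad.bidualMap hX, NumRad.bidualMap_apply hX,
      NumRad.isCompleteIsometry_bidualMap hX⟩,
    fun _ hN => NumRad.isNumRadSpace_quotNorms hX hN⟩
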